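/- \textbf{Setting.} Let $\mathcal H$ be a finite-dimensional Hilbert space (identified with $\mathbb C^n$), let $\{\rho_\theta:\theta\in\Theta\subset\mathbb R^2\}$ be a smooth family of density operators on $\mathcal H$, and let $\theta_0$ be an interior point of $\Theta$ such that $\rho:=\rho_{\theta_0}$ is strictly positive and the partial derivatives $\partial_1\rho,\partial_2\rho$ at $\theta_0$ are linearly independent over $\mathbb R$. Let $G$ be a real symmetric positive definite $2\times2$ matrix. For $\beta\in[0,1]$ let $L_i^{(\beta)}$ be the unique solution of $\partial_i\rho=\frac{1+\beta}{2}\rho L_i^{(\beta)}+\frac{1-\beta}{2}L_i^{(\beta)}\rho$; put $J^{(\beta)}=[\operatorname{Tr}\partial_i\rho\,L_j^{(\beta)}]_{ij}$, $J^{(S)}=J^{(0)}$, $J^{(R)}=J^{(1)}$, $L_i^{(S)}=L_i^{(0)}$, and $$C^{(\beta)}=\operatorname{Tr}G\,(J^{(\beta)})^{-1}+\operatorname{Tr}\bigl|\sqrt G\,\operatorname{Im}\bigl((J^{(\beta)})^{-1}\bigr)\sqrt G\bigr| .$$ The Holevo bound $C^{(H)}$ is the minimum of $\operatorname{Tr}GV$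 over all real matrices $V$ and Hermitian operators $B_1,B_2$ on $\mathcal H$ with $\operatorname{Tr}\partial_i\rho\,B_j=\delta_{ij}$ and $V\ge Z(B)$, where $Z_{ij}(B)=\operatorname{Tr}\rho B_jB_i$. The commutation operator $\mathcal D_\rho$ is defined by $\mathcal D_\rho(X)\rho+\rho\,\mathcal D_\rho(X)=\sqrt{-1}\,(X\rho-\rho X)$, and $\langle X,Y\rangle=\frac12\operatorname{Tr}X^*(\rho Y+Y\rho)$. \textbf{Theorem.} Suppose that there is a three-dimensional real space $\tilde{\mathcal T}$ of Hermitian operators that contains $L_1^{(S)},L_2^{(S)}$ and satisfies $\mathcal D_\rho(\tilde{\mathcal T})\subset\tilde{\mathcal T}$. (1) The minimum $C^{(H)}$ and the maximum $\max_{0\le\beta\le1}C^{(\beta)}$ are attained, and $$C^{(H)}=\max_{0\le\beta\le1}C^{(\beta)} .$$ (2) This common value is $C^{(1)}$ if $\hat\beta\ge1$ and $C^{(\hat\beta)}$ otherwise, where $$\hat\beta=\frac{\operatorname{Tr}\bigl|\sqrt G\,\operatorname{Im}\bigl((J^{(R)})^{-1}\bigr)\sqrt G\bigr|}{2\operatorname{Tr}G\{(J^{(S)})^{-1}-\operatorname{Re}((J^{(R)})^{-1})\}}\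 \text{ if }(J^{(S)})^{-1}\ne\operatorname{Re}((J^{(R)})^{-1}),\qquad \hat\beta=\infty\ \text{ otherwise.}$$ (3) The maximisation is the Lagrangian dual of the Holevo minimisation, in the following sense. There is $D_3\in\tilde{\mathcal T}$ with $\langle D_3,D_3\rangle=1$ and $\langle L_i^{(S)},D_3\rangle=0$ for $i=1,2$. For each such $D_3$ put $(D_1,D_2)=(L_1^{(S)},L_2^{(S)})$, $\Sigma=[\operatorname{Tr}\rho D_jD_i]_{1\le i,j\le3}$ and $R=(\operatorname{Re}\Sigma)^{-1}\Sigma(\operatorname{Re}\Sigma)^{-1}$, let $A$ be the upper left $2\times2$ block of $R$, let $b\in\mathbb R^2$ be the imaginary part of its upper right $2\times1$ block, $\kappa=b^{\intercal}Gb$, let $a$ be the $(2,1)$ entry of $\sqrt G\operatorname{Im}(A)\sqrt G$, and let $$g_1(\beta)=\operatorname{Tr}G\operatorname{Re}A+\beta\operatorname{Tr}\bigl|\sqrt G\operatorname{Im}(A)\sqrt G\bigr|-\beta^2\kappa,\qquad g_2(t)=\operatorname{Tr}G\operatorname{Re}A+\kappa t^2+2|a|+2\kappa t .$$ Then every value $g_2(t)$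 with $|a|+\kappa t\ge0$ is the value $\operatorname{Tr}GV$ of a feasible point of the Holevo minimisation, and $C^{(H)}$ is the (attained) minimum of $g_2(t)$ over the $t\in\mathbb R$ with $|a|+\kappa t\ge0$. The Lagrangian dual function of this quadratic program is, for every $\lambda\in\mathbb R$, $$\min_{t\in\mathbb R}\bigl\{g_2(t)-\lambda(|a|+\kappa t)\bigr\}=g_1\Bigl(\frac{2-\lambda}{2}\Bigr),$$ one has $g_1(\beta)=C^{(\beta)}$ for $0\le\beta\le1$, and the dual problem satisfies $$\max_{\lambda\ge0}g_1\Bigl(\frac{2-\lambda}{2}\Bigr)=\max_{0\le\beta\le1}C^{(\beta)} .$$ -/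

import Mathlib

open scoped Matrix ComplexOrder MatrixOrder ContDiff

noncomputable section

namespace QuantumEstimation

/-! ### Real and imaginary parts, absolute value and square root of matrices -/

/-- Entrywise real part of a complex matrix. -/
def reM {ι κ : Type*} (M : Matrix ι κ ℂ) : Matrix ι κ ℝ := M.map Complex.re

/-- Entrywise imaginary part of a complex matrix. -/
def imM {ι κ : Type*} (M : Matrix ι κ ℂ) : Matrix ι κ ℝ := M.map Complex.im

/-- A real matrix regarded as a complex one. -/
def toC {ι κ : Type*} (M : Matrix ι κ ℝ) : Matrix ι κ ℂ := M.map Complex.ofReal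

/-- The absolute value `|X| = √(Xᵀ X)` of a real square matrix. -/
def absM {ι : Type*} [Fintype ι] [DecidableEq ι] (X : Matrix ι ι ℝ) : Matrix ι ι ℝ :=
  CFC.sqrt (Xᵀ * X)

/-- `Tr |√G (Im Z) √G|`. -/
def imCost {d : ℕ} (G : Matrix (Fin d) (Fin d) ℝ) (Z : Matrix (Fin d) (Fin d) ℂ) : ℝ :=
  (absM (CFC.sqrt G * imM Z * CFC.sqrt G)).trace

/-! ### Quantum statistical models -/

/-- A smooth `d`-parameter family of density operators on the Hilbert space `ℂⁿ`. -/
structure QuantumModel (d : ℕ) (n : Type*) [Fintype n] where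
  /-- the parameter set -/
  Θ : Set (EuclideanSpace ℝ (Fin d))
  /-- the states, only meaningful on `Θ` -/
  ρ : EuclideanSpace ℝ (Fin d) → Matrix n n ℂ
  smooth : ∀ a b, ContDiffOn ℝ ∞ (fun θ => ρ θ a b) Θ
  posSemidef : ∀ θ ∈ Θ, (ρ θ).PosSemidef
  trace_one : ∀ θ ∈ Θ, (ρ θ).trace = 1

variable {n : Type*} [Fintype n]

/-- The partial derivative `∂ᵢ ρ` at `θ₀`. -/
def QuantumModel.partialDeriv {d : ℕ} (S : QuantumModel d n) (θ₀ : EuclideanSpace ℝ (Fin d))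
    (i : Fin d) : Matrix n n ℂ :=
  Matrix.of fun a b => fderiv ℝ (fun θ => S.ρ θ a b) θ₀ (EuclideanSpace.single i 1)

/-! ### Logarithmic derivatives and the commutation operator -/

/-- The superoperator `X ↦ (1+β)/2 · ρ X + (1-β)/2 · X ρ`. -/
def betaMap (ρ : Matrix n n ℂ) (β : ℝ) : Module.End ℂ (Matrix n n ℂ) :=
  (((1 + β) / 2 : ℝ) : ℂ) • LinearMap.mulLeft ℂ ρ
    + (((1 - β) / 2 : ℝ) : ℂ) • LinearMap.mulRight ℂ ρ

/-- The solution `L` of `Y = (1+β)/2 · ρ L + (1-β)/2 · L ρ`. -/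
def logDeriv (ρ : Matrix n n ℂ) (β : ℝ) (Y : Matrix n n ℂ) : Matrix n n ℂ :=
  Ring.inverse (betaMap ρ β) Y

/-- The commutation operator: the solution `D X` of `(D X) ρ + ρ (D X) = √-1 (X ρ - ρ X)`. -/
def commOp (ρ : Matrix n n ℂ) (X : Matrix n n ℂ) : Matrix n n ℂ :=
  logDeriv ρ 0 ((Complex.I / 2) • (X * ρ - ρ * X))

/-- The sesquilinear form `⟨X, Y⟩^(β) = 1/2 Tr X* {(1+β) ρ Y + (1-β) Y ρ}`. -/
def innerBeta (ρ : Matrix n n ℂ) (β : ℝ) (X Y : Matrix n n ℂ) : ℂ :=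
  (1 / 2 : ℂ) * (Xᴴ * ((1 + β : ℂ) • (ρ * Y) + (1 - β : ℂ) • (Y * ρ))).trace

theorem betaMap_apply (ρ : Matrix n n ℂ) (β : ℝ) (X : Matrix n n ℂ) :
    betaMap ρ β X
      = (((1 + β) / 2 : ℝ) : ℂ) • (ρ * X) + (((1 - β) / 2 : ℝ) : ℂ) • (X * ρ) := by
  simp [betaMap]

theorem eq_zero_of_trace_eq_zero {ρ : Matrix n n ℂ} (hρ : ρ.PosDef) {X : Matrix n n ℂ}
    (h : (Xᴴ * ρ * X).trace = 0) : X = 0 := by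
  classical
  have h0 : Xᴴ * ρ * X = 0 :=
    ((hρ.posSemidef.conjTranspose_mul_mul_same X).trace_eq_zero_iff).1 h
  ext i j
  by_contra hne
  have hx : (X *ᵥ Pi.single j 1) ≠ 0 := by
    intro h1
    apply hne
    have := congrFun h1 i
    simpa using this
  have hpos := hρ.dotProduct_mulVec_pos hx
  have : star (X *ᵥ Pi.single j 1) ⬝ᵥ (ρ *ᵥ (X *ᵥ Pi.single j 1))
      = star (Pi.single j 1 : n → ℂ) ⬝ᵥ ((Xᴴ * ρ * X) *ᵥ Pi.single j 1) := by
    simp only [Matrix.star_mulVec, Matrix.dotProduct_mulVec, Matrix.vecMul_vecMul, Matrix.mul_assoc]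
  rw [this, h0] at hpos
  simp at hpos

/-- For a faithful state and `|β| ≤ 1` the equation defining the `β` logarithmic derivative
is uniquely solvable. -/
theorem betaMap_isUnit {ρ : Matrix n n ℂ} (hρ : ρ.PosDef) {β : ℝ} (hβ : |β| ≤ 1) :
    IsUnit (betaMap ρ β) := by
  classical
  rw [LinearMap.isUnit_iff_ker_eq_bot, LinearMap.ker_eq_bot']
  intro X hX
  obtain ⟨h1, h2⟩ := abs_le.1 hβ
  have e : (((1 + β) / 2 : ℝ) : ℂ) * (Xᴴ * ρ * X).trace
      + (((1 - β) / 2 : ℝ) : ℂ) * (Xᴴᴴ * ρ * Xᴴ).trace = 0 := by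
    have := congrArg (fun M => (Xᴴ * M).trace) hX
    simp only [betaMap_apply, Matrix.mul_add, Matrix.mul_smul, Matrix.trace_add,
      Matrix.trace_smul, smul_eq_mul, Matrix.mul_zero, Matrix.trace_zero] at this
    rw [Matrix.conjTranspose_conjTranspose, ← this, Matrix.mul_assoc Xᴴ,
      Matrix.trace_mul_comm (X * ρ) Xᴴ]
  have p1 : 0 ≤ (Xᴴ * ρ * X).trace :=
    (hρ.posSemidef.conjTranspose_mul_mul_same X).trace_nonneg
  have p2 : 0 ≤ (Xᴴᴴ * ρ * Xᴴ).trace :=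
    (hρ.posSemidef.conjTranspose_mul_mul_same Xᴴ).trace_nonneg
  have c1 : (0 : ℂ) ≤ (((1 + β) / 2 : ℝ) : ℂ) := by
    rw [Complex.zero_le_real]; linarith
  have c2 : (0 : ℂ) ≤ (((1 - β) / 2 : ℝ) : ℂ) := by
    rw [Complex.zero_le_real]; linarith
  obtain ⟨e1, e2⟩ := (add_eq_zero_iff_of_nonneg (mul_nonneg c1 p1) (mul_nonneg c2 p2)).1 e
  rcases mul_eq_zero.1 e1 with h | h
  · rcases mul_eq_zero.1 e2 with h' | h'
    · rw [Complex.ofReal_eq_zero] at h h'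
      linarith
    · have := eq_zero_of_trace_eq_zero hρ h'
      simpa using this
  · exact eq_zero_of_trace_eq_zero hρ h

theorem logDeriv_spec {ρ : Matrix n n ℂ} (hρ : ρ.PosDef) {β : ℝ} (hβ : |β| ≤ 1)
    (Y L : Matrix n n ℂ) :
    logDeriv ρ β Y = L ↔
      Y = (((1 + β) / 2 : ℝ) : ℂ) • (ρ * L) + (((1 - β) / 2 : ℝ) : ℂ) • (L * ρ) := by
  have hu := betaMap_isUnit hρ hβ
  rw [← betaMap_apply]
  constructor
  · rintro rfl
    have := congrArg (fun f : Module.End ℂ (Matrix n n ℂ) => f Y) (Ring.mul_inverse_cancel _ hu)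
    simpa [logDeriv] using this.symm
  · rintro rfl
    have := congrArg (fun f : Module.End ℂ (Matrix n n ℂ) => f L) (Ring.inverse_mul_cancel _ hu)
    simpa [logDeriv] using this

theorem commOp_spec {ρ : Matrix n n ℂ} (hρ : ρ.PosDef) (X E : Matrix n n ℂ) :
    commOp ρ X = E ↔ E * ρ + ρ * E = Complex.I • (X * ρ - ρ * X) := by
  rw [commOp, logDeriv_spec hρ (by simp)]
  have e : (Complex.I / 2) • (X * ρ - ρ * X) = (2⁻¹ : ℂ) • (Complex.I • (X * ρ - ρ * X)) := by
    rw [smul_smul]; congr 1; ring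
  have e' : (((1 + (0 : ℝ)) / 2 : ℝ) : ℂ) • (ρ * E) + (((1 - (0 : ℝ)) / 2 : ℝ) : ℂ) • (E * ρ)
      = (2⁻¹ : ℂ) • (E * ρ + ρ * E) := by
    rw [add_comm, smul_add]; norm_num
  rw [e, e']
  constructor
  · intro h
    exact (smul_right_injective _ (by norm_num : (2⁻¹ : ℂ) ≠ 0) h).symm
  · intro h
    rw [h]

/-! ### Fisher information matrices and the bounds -/

namespace QuantumModel

variable {d : ℕ} (S : QuantumModel d n) (θ₀ : EuclideanSpace ℝ (Fin d))
  (G : Matrix (Fin d) (Fin d) ℝ)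

/-- The `β` logarithmic derivative `Lᵢ^(β)` (`β = 0`: SLD, `β = 1`: RLD). -/
def L (β : ℝ) (i : Fin d) : Matrix n n ℂ := logDeriv (S.ρ θ₀) β (S.partialDeriv θ₀ i)

/-- The `β` Fisher information matrix `J^(β) = [Tr (∂ᵢ ρ) Lⱼ^(β)]`. -/
def J (β : ℝ) : Matrix (Fin d) (Fin d) ℂ :=
  Matrix.of fun i j => (S.partialDeriv θ₀ i * S.L θ₀ β j).trace

/-- `C^(β) = Tr G J^(β)⁻¹ + Tr |√G Im(J^(β)⁻¹) √G|`. -/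
def betaBound (β : ℝ) : ℝ :=
  (toC G * (S.J θ₀ β)⁻¹).trace.re + imCost G (S.J θ₀ β)⁻¹

/-- The maximum logarithmic derivative bound. -/
def mldBound : ℝ := sSup (S.betaBound θ₀ G '' Set.Icc 0 1)

/-- The matrix `Z(B)` with entries `Zᵢⱼ = Tr ρ Bⱼ Bᵢ`. -/
def Z {ι : Type*} (B : ι → Matrix n n ℂ) : Matrix ι ι ℂ :=
  Matrix.of fun i j => (S.ρ θ₀ * B j * B i).trace

/-- Feasibility in the minimisation problem defining the Holevo bound. -/
structure HolevoFeasible (V : Matrix (Fin d) (Fin d) ℝ) (B : Fin d → Matrix n n ℂ) : Prop where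
  hermitian : ∀ j, (B j).IsHermitian
  unbiased : ∀ i j, (S.partialDeriv θ₀ i * B j).trace = if i = j then 1 else 0
  le : (toC V - S.Z θ₀ B).PosSemidef

/-- The values `Tr G V` taken in the minimisation problem defining the Holevo bound. -/
def holevoValues : Set ℝ :=
  {x | ∃ V B, S.HolevoFeasible θ₀ V B ∧ x = (G * V).trace}

/-- The Holevo bound. -/
def holevoBound : ℝ := sInf (S.holevoValues θ₀ G)

open scoped Classical in
/-- The extended real number `β̂` in the explicit formula. -/
def betaHat : EReal :=
  if (S.J θ₀ 0)⁻¹ ≠ toC (reM (S.J θ₀ 1)⁻¹) then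
    ((imCost G (S.J θ₀ 1)⁻¹
      / (2 * (G * (reM (S.J θ₀ 0)⁻¹ - reM (S.J θ₀ 1)⁻¹)).trace) : ℝ) : EReal)
  else ⊤

/-- `T` is a real space of Hermitian operators which contains the SLDs and is invariant under the
commutation operator. -/
structure IsInvariantExtension (T : Submodule ℝ (Matrix n n ℂ)) : Prop where
  hermitian : ∀ X ∈ T, X.IsHermitian
  sld_mem : ∀ i, S.L θ₀ 0 i ∈ T
  invariant : ∀ X ∈ T, commOp (S.ρ θ₀) X ∈ T

/-- `D` is a unit vector of `T` orthogonal to the SLDs for `⟨·,·⟩^(0)`. -/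
structure IsUnitNormal (T : Submodule ℝ (Matrix n n ℂ)) (D : Matrix n n ℂ) : Prop where
  mem : D ∈ T
  orthogonal : ∀ i, innerBeta (S.ρ θ₀) 0 (S.L θ₀ 0 i) D = 0
  unit : innerBeta (S.ρ θ₀) 0 D D = 1

/-! ### The quadratic program obtained from the Holevo minimisation -/

/-- `R = (Re Σ)⁻¹ Σ (Re Σ)⁻¹` for the tuple consisting of the SLDs followed by `D`,
where `Σᵢⱼ = Tr ρ Dⱼ Dᵢ`. -/
def R (D : Matrix n n ℂ) : Matrix (Fin (d + 1)) (Fin (d + 1)) ℂ :=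
  let Sig : Matrix (Fin (d + 1)) (Fin (d + 1)) ℂ :=
    S.Z θ₀ (Fin.snoc (α := fun _ => Matrix n n ℂ) (S.L θ₀ 0) D)
  toC (reM Sig)⁻¹ * Sig * toC (reM Sig)⁻¹

/-- The upper left `d × d` block `A` of `R`. -/
def A (D : Matrix n n ℂ) : Matrix (Fin d) (Fin d) ℂ :=
  (S.R θ₀ D).submatrix Fin.castSucc Fin.castSucc

/-- The real vector `b` for which the upper right `d × 1` block of `R` is `√-1 b`. -/
def b (D : Matrix n n ℂ) : Fin d → ℝ := fun i => (S.R θ₀ D (Fin.castSucc i) (Fin.last d)).im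

/-- `⟨b| G |b⟩`. -/
def bGb (D : Matrix n n ℂ) : ℝ := S.b θ₀ D ⬝ᵥ (G *ᵥ S.b θ₀ D)

/-- `g₁(β) = Tr G Re A + β Tr |√G Im A √G| - β² ⟨b|G|b⟩`. -/
def g₁ (D : Matrix n n ℂ) (β : ℝ) : ℝ :=
  (G * reM (S.A θ₀ D)).trace + β * imCost G (S.A θ₀ D) - β ^ 2 * S.bGb θ₀ G D

end QuantumModel

section two

variable (S : QuantumModel 2 n) (θ₀ : EuclideanSpace ℝ (Fin 2)) (G : Matrix (Fin 2) (Fin 2) ℝ)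
  (D : Matrix n n ℂ)

/-- The real number `a` with `√G (Im A) √G = a • !![0, -1; 1, 0]`. -/
def QuantumModel.a : ℝ := (CFC.sqrt G * imM (S.A θ₀ D) * CFC.sqrt G) 1 0

/-- Objective `g₂(t) = Tr G Re A + ⟨b|G|b⟩ t² + 2|a| + 2⟨b|G|b⟩ t` of the quadratic program. -/
def QuantumModel.g₂ (t : ℝ) : ℝ :=
  (G * reM (S.A θ₀ D)).trace + S.bGb θ₀ G D * t ^ 2 + 2 * |S.a θ₀ G D| + 2 * S.bGb θ₀ G D * t

/-- Constraint function of the quadratic program, whose constraint is `0 ≤ |a| + ⟨b|G|b⟩ t`. -/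
def QuantumModel.con (t : ℝ) : ℝ := |S.a θ₀ G D| + S.bGb θ₀ G D * t

/-- The Lagrangian of the problem of minimising `f t` subject to `0 ≤ c t`. -/
def lagrangian (f c : ℝ → ℝ) (t l : ℝ) : ℝ := f t - l * c t

end two

end QuantumEstimation

end

/-!
The proof reduces both bounds to the same pair of scalar problems in the three-dimensional space
`T`, which the commutation operator `𝒟` preserves.

Let `F` be the frame of `T` consisting of the symmetric logarithmic derivatives and the unit normal
`D`, and `E` its dual frame for the symmetric inner product. Then `R = Z(E)`, and the real and
imaginary parts of `R` are the coordinate matrices of `E` and of `𝒟 E` with respect to `F`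
(`dualFrame_eq_sum`, `commOp_dualFrame_eq_sum`). The equation of the `β` logarithmic derivative is
the symmetric one twisted by `1 + √-1 β 𝒟`, which preserves the complexification of `T`.
Eliminating the coordinate along `D` shows that the inverse of the `β` Fisher information matrix is
the Schur complement `Re A + √-1 β Im A - β² b bᵀ` (`inv_J`). Hence `C^(β) = g₁(β)` on `[0, 1]`
(`betaBound_eq_g₁`), and `β̂ = |a| / κ` with `κ = ⟨b|G|b⟩` (`betaHat_eq`).

On the side of the Holevo bound, unbiasedness forces `Bⱼ = Eⱼ + fⱼ D + Nⱼ` with `Nⱼ` orthogonal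
to `T`, and invariance of `T` makes `Z(B)` the sum of `A + f fᵀ + √-1 (b fᵀ - f bᵀ)` and `Z(N) ≥ 0`
(`HolevoFeasible.exists_posSemidef_sub_shiftedZ`). Evaluating `V - Z(B) ≥ 0` at the two vectors
`√G (1, ±√-1)` and completing the square in `√G f` gives weak duality `g₁(β) ≤ Tr G V`
(`g₁_le_of_mem_holevoValues`). Conversely, taking `√G f` to be `√G b` turned by a right angle and
scaled by `t` produces feasible points with value `g₂(t)` (`g₂_mem_holevoValues`).

What remains is to match the parabola `g₁(β) = const + 2 β |a| - β² κ` on `[0, 1]` with `g₂` on the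
half-line `0 ≤ |a| + κ t`: at the maximiser `β` of the former, the point `t = -β` is feasible and
complementary slackness gives `g₂(-β) = g₁(β)` (`exists_saddle`, `two_mul_sub_sq_mul_le`).
-/

noncomputable section

namespace QuantumEstimation

section general

variable {n : Type*} [Fintype n]

/-! ### The symmetrised trace form -/

/-- The complex bilinear form `1/2 Tr (ρ X + X ρ) Y`. On Hermitian matrices it agrees with the
symmetric logarithmic derivative inner product; bilinearity, as opposed to sesquilinearity, lets
complex combinations of Hermitian matrices be paired without conjugations. -/
def symPair (ρ : Matrix n n ℂ) : Matrix n n ℂ →ₗ[ℂ] Matrix n n ℂ →ₗ[ℂ] ℂ :=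
  LinearMap.mk₂ ℂ (fun X Y => (1 / 2 : ℂ) * ((ρ * X + X * ρ) * Y).trace)
    (fun X X' Y => by simp only [mul_add, add_mul, Matrix.trace_add]; ring)
    (fun c X Y => by
      simp only [mul_add, add_mul, Matrix.trace_add, Matrix.mul_smul, Matrix.smul_mul,
        Matrix.trace_smul, smul_eq_mul]; ring)
    (fun X Y Y' => by simp only [mul_add, Matrix.trace_add])
    (fun c X Y => by simp only [Matrix.mul_smul, Matrix.trace_smul, smul_eq_mul]; ring)

theorem symPair_apply (ρ X Y : Matrix n n ℂ) :
    symPair ρ X Y = (1 / 2 : ℂ) * ((ρ * X + X * ρ) * Y).trace := rfl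

theorem symPair_comm (ρ X Y : Matrix n n ℂ) : symPair ρ X Y = symPair ρ Y X := by
  simp only [symPair_apply, add_mul, Matrix.trace_add]
  rw [Matrix.trace_mul_cycle ρ X Y, Matrix.trace_mul_comm (Y * ρ) X, ← Matrix.mul_assoc X Y ρ,
    Matrix.trace_mul_cycle X Y ρ, Matrix.trace_mul_comm (X * ρ) Y, ← Matrix.mul_assoc Y X ρ,
    Matrix.trace_mul_cycle Y X ρ]
  ring

theorem star_symPair {ρ X Y : Matrix n n ℂ} (hρ : ρ.IsHermitian) (hX : X.IsHermitian)
    (hY : Y.IsHermitian) : star (symPair ρ X Y) = symPair ρ X Y := by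
  rw [symPair_apply, star_mul', ← Matrix.trace_conjTranspose]
  simp only [Matrix.conjTranspose_mul, Matrix.conjTranspose_add, hρ.eq, hX.eq, hY.eq]
  rw [Matrix.trace_mul_comm, add_comm]
  simp

theorem symPair_eq_ofReal {ρ X Y : Matrix n n ℂ} (hρ : ρ.IsHermitian) (hX : X.IsHermitian)
    (hY : Y.IsHermitian) : symPair ρ X Y = ((symPair ρ X Y).re : ℂ) :=
  (Complex.conj_eq_iff_re.1 (star_symPair hρ hX hY)).symm

theorem innerBeta_zero_eq_symPair {ρ X Y : Matrix n n ℂ} (hX : X.IsHermitian) :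
    innerBeta ρ 0 X Y = symPair ρ X Y := by
  rw [symPair_comm, symPair_apply, innerBeta, hX.eq, Matrix.trace_mul_comm]
  simp

theorem symPair_self_eq_trace (ρ X : Matrix n n ℂ) (hX : X.IsHermitian) :
    symPair ρ X X = (Xᴴ * ρ * X).trace := by
  rw [symPair_apply, add_mul, Matrix.trace_add, hX.eq, Matrix.trace_mul_cycle ρ X X]
  ring

theorem symPair_self_nonneg {ρ X : Matrix n n ℂ} (hρ : ρ.PosDef) (hX : X.IsHermitian) :
    0 ≤ symPair ρ X X := by
  rw [symPair_self_eq_trace ρ X hX]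
  exact (hρ.posSemidef.conjTranspose_mul_mul_same X).trace_nonneg

theorem eq_zero_of_symPair_self_eq_zero {ρ X : Matrix n n ℂ} (hρ : ρ.PosDef)
    (hX : X.IsHermitian) (h : symPair ρ X X = 0) : X = 0 :=
  eq_zero_of_trace_eq_zero hρ (by rw [← symPair_self_eq_trace ρ X hX, h])

/-- The trace `Tr ρ Y X` splits into the symmetric form and the commutation operator. -/
theorem trace_mul_mul_eq_symPair {ρ : Matrix n n ℂ} (hρ : ρ.PosDef) (X Y : Matrix n n ℂ) :
    (ρ * Y * X).trace = symPair ρ X Y - Complex.I * symPair ρ (commOp ρ X) Y := by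
  have h := (commOp_spec hρ X _).1 rfl
  have e : ρ * commOp ρ X + commOp ρ X * ρ = Complex.I • (X * ρ - ρ * X) := by rw [← h, add_comm]
  rw [symPair_apply, symPair_apply, e, Matrix.smul_mul, Matrix.trace_smul, sub_mul, add_mul,
    Matrix.trace_sub, Matrix.trace_add, Matrix.trace_mul_cycle ρ Y X, smul_eq_mul]
  linear_combination (1 / 2 * ((X * ρ * Y).trace - (ρ * X * Y).trace)) * Complex.I_sq

/-- The equation of the `β` logarithmic derivative is that of the symmetric one, twisted by
`1 + √-1 β 𝒟`. -/
theorem betaMap_eq_betaMap_zero {ρ : Matrix n n ℂ} (hρ : ρ.PosDef) (β : ℝ) (X : Matrix n n ℂ) :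
    betaMap ρ β X = betaMap ρ 0 (X + (Complex.I * β) • commOp ρ X) := by
  have h := (commOp_spec hρ X _).1 rfl
  have e : ρ * commOp ρ X = Complex.I • (X * ρ - ρ * X) - commOp ρ X * ρ := by
    rw [← h]; abel
  rw [map_add, map_smul, betaMap_apply, betaMap_apply, betaMap_apply, e]
  have hI : Complex.I * Complex.I = -1 := Complex.I_mul_I
  ext i j
  simp only [Matrix.add_apply, Matrix.smul_apply, Matrix.sub_apply, smul_eq_mul]
  push_cast
  linear_combination (-(β : ℂ) / 2 * ((X * ρ) i j - (ρ * X) i j)) * hI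

theorem trace_betaMap_zero_mul (ρ X Y : Matrix n n ℂ) :
    (betaMap ρ 0 X * Y).trace = symPair ρ X Y := by
  rw [symPair_apply, betaMap_apply]
  simp [add_mul]
  ring

/-! ### Frames of an invariant space -/

namespace QuantumModel

variable {d : ℕ} {S : QuantumModel d n} {θ₀ : EuclideanSpace ℝ (Fin d)}
  {T : Submodule ℝ (Matrix n n ℂ)} {D : Matrix n n ℂ}

theorem betaMap_zero_L (hρ : (S.ρ θ₀).PosDef) (i : Fin d) :
    betaMap (S.ρ θ₀) 0 (S.L θ₀ 0 i) = S.partialDeriv θ₀ i := by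
  rw [betaMap_apply]
  exact ((logDeriv_spec hρ (by simp) _ _).1 rfl).symm

theorem trace_partialDeriv_mul (hρ : (S.ρ θ₀).PosDef) (i : Fin d) (X : Matrix n n ℂ) :
    (S.partialDeriv θ₀ i * X).trace = symPair (S.ρ θ₀) (S.L θ₀ 0 i) X := by
  rw [← betaMap_zero_L hρ, trace_betaMap_zero_mul]

theorem linearIndependent_L (hρ : (S.ρ θ₀).PosDef)
    (hindep : LinearIndependent ℝ (S.partialDeriv θ₀)) :
    LinearIndependent ℝ (S.L θ₀ 0) := by
  refine LinearIndependent.of_comp ((betaMap (S.ρ θ₀) 0).restrictScalars ℝ) ?_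
  convert hindep using 1
  funext i
  exact betaMap_zero_L hρ i

/-- A space of dimension larger than the number of parameters contains a unit normal. -/
theorem exists_isUnitNormal (hρ : (S.ρ θ₀).PosDef) (hT : S.IsInvariantExtension θ₀ T)
    (hdim : Module.finrank ℝ T = d + 1) : ∃ D, S.IsUnitNormal θ₀ T D := by
  let f : T →ₗ[ℝ] (Fin d → ℝ) :=
    LinearMap.pi fun i => Complex.reLm ∘ₗ
      ((symPair (S.ρ θ₀) (S.L θ₀ 0 i)).restrictScalars ℝ) ∘ₗ T.subtype
  have : FiniteDimensional ℝ T := Module.finite_of_finrank_pos (by omega)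
  have hk : LinearMap.ker f ≠ ⊥ := LinearMap.ker_ne_bot_of_finrank_lt (by simp [hdim])
  obtain ⟨⟨X, hXT⟩, hXk, hX0⟩ := Submodule.exists_mem_ne_zero_of_ne_bot hk
  have hX0' : X ≠ 0 := fun h => hX0 (by simp [h])
  have hXh := hT.hermitian X hXT
  have hρh := hρ.isHermitian
  have horth : ∀ i, symPair (S.ρ θ₀) (S.L θ₀ 0 i) X = 0 := fun i => by
    rw [symPair_eq_ofReal hρh (hT.hermitian _ (hT.sld_mem i)) hXh]
    have := congrFun (LinearMap.mem_ker.1 hXk) i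
    simpa [f] using this
  have hs := symPair_eq_ofReal hρh hXh hXh
  set s := (symPair (S.ρ θ₀) X X).re
  have hs0 : 0 < s := by
    have h1 := symPair_self_nonneg hρ hXh
    rw [hs, Complex.zero_le_real] at h1
    refine lt_of_le_of_ne h1 fun h => hX0' (eq_zero_of_symPair_self_eq_zero hρ hXh ?_)
    rw [hs, ← h]; simp
  have hDT : (√s)⁻¹ • X ∈ T := T.smul_mem _ hXT
  refine ⟨(√s)⁻¹ • X, hDT, fun i => ?_, ?_⟩
  · rw [innerBeta_zero_eq_symPair (hT.hermitian _ (hT.sld_mem i)), LinearMap.map_smul_of_tower,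
      horth, smul_zero]
  · rw [innerBeta_zero_eq_symPair (hT.hermitian _ hDT), LinearMap.map_smul_of_tower,
      LinearMap.map_smul_of_tower, LinearMap.smul_apply, hs, smul_smul, Complex.real_smul,
      ← Complex.ofReal_mul, ← Complex.ofReal_one]
    congr 1
    rw [← mul_inv, Real.mul_self_sqrt hs0.le, inv_mul_cancel₀ hs0.ne']

variable (S θ₀ D) in
/-- The tuple consisting of the symmetric logarithmic derivatives followed by `D`. -/
def frame : Fin (d + 1) → Matrix n n ℂ := Fin.snoc (α := fun _ => Matrix n n ℂ) (S.L θ₀ 0) D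

variable (S θ₀ D) in
/-- The Gram matrix of `frame`. -/
def gram : Matrix (Fin (d + 1)) (Fin (d + 1)) ℝ := reM (S.Z θ₀ (S.frame θ₀ D))

variable (S θ₀ D) in
/-- The dual frame, obtained from `frame` by the inverse of its Gram matrix. -/
def dualFrame (j : Fin (d + 1)) : Matrix n n ℂ := ∑ k, (S.gram θ₀ D)⁻¹ k j • S.frame θ₀ D k

@[simp] theorem frame_castSucc (i : Fin d) : S.frame θ₀ D i.castSucc = S.L θ₀ 0 i := by
  simp [frame]

@[simp] theorem frame_last : S.frame θ₀ D (Fin.last d) = D := by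
  simp [frame]

theorem Z_eq_symPair (hρ : (S.ρ θ₀).PosDef) {ι : Type*} (B : ι → Matrix n n ℂ) (i j : ι) :
    S.Z θ₀ B i j = symPair (S.ρ θ₀) (B i) (B j)
      - Complex.I * symPair (S.ρ θ₀) (commOp (S.ρ θ₀) (B i)) (B j) :=
  trace_mul_mul_eq_symPair hρ _ _

theorem frame_mem (hT : S.IsInvariantExtension θ₀ T) (hD : S.IsUnitNormal θ₀ T D)
    (i : Fin (d + 1)) : S.frame θ₀ D i ∈ T := by
  refine Fin.lastCases ?_ (fun i => ?_) i
  · simpa using hD.mem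
  · simpa using hT.sld_mem i

theorem Z_re_of_mem (hρ : (S.ρ θ₀).PosDef) (hT : S.IsInvariantExtension θ₀ T) {ι : Type*}
    {B : ι → Matrix n n ℂ} (hB : ∀ i, B i ∈ T) (i j : ι) :
    ((S.Z θ₀ B i j).re : ℂ) = symPair (S.ρ θ₀) (B i) (B j) := by
  have h1 := symPair_eq_ofReal hρ.isHermitian (hT.hermitian _ (hB i)) (hT.hermitian _ (hB j))
  have h2 := symPair_eq_ofReal hρ.isHermitian (hT.hermitian _ (hT.invariant _ (hB i)))
    (hT.hermitian _ (hB j))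
  rw [Z_eq_symPair hρ, h1, h2]
  simp

theorem Z_im_of_mem (hρ : (S.ρ θ₀).PosDef) (hT : S.IsInvariantExtension θ₀ T) {ι : Type*}
    {B : ι → Matrix n n ℂ} (hB : ∀ i, B i ∈ T) (i j : ι) :
    ((S.Z θ₀ B i j).im : ℂ) = -symPair (S.ρ θ₀) (commOp (S.ρ θ₀) (B i)) (B j) := by
  have h1 := symPair_eq_ofReal hρ.isHermitian (hT.hermitian _ (hB i)) (hT.hermitian _ (hB j))
  have h2 := symPair_eq_ofReal hρ.isHermitian (hT.hermitian _ (hT.invariant _ (hB i)))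
    (hT.hermitian _ (hB j))
  rw [Z_eq_symPair hρ, h1, h2]
  simp

theorem star_trace_mul_mul {ρ X Y : Matrix n n ℂ} (hρ : ρ.IsHermitian) (hX : X.IsHermitian)
    (hY : Y.IsHermitian) : star (ρ * X * Y).trace = (ρ * Y * X).trace := by
  rw [← Matrix.trace_conjTranspose]
  simp only [Matrix.conjTranspose_mul, hρ.eq, hX.eq, hY.eq]
  rw [← Matrix.mul_assoc, ← Matrix.trace_mul_cycle, ← Matrix.trace_mul_cycle]

theorem star_Z {ι : Type*} (hρ : (S.ρ θ₀).PosDef) {B : ι → Matrix n n ℂ}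
    (hB : ∀ i, (B i).IsHermitian) (i j : ι) : star (S.Z θ₀ B i j) = S.Z θ₀ B j i :=
  star_trace_mul_mul hρ.isHermitian (hB j) (hB i)

theorem gram_apply (hρ : (S.ρ θ₀).PosDef) (hT : S.IsInvariantExtension θ₀ T)
    (hD : S.IsUnitNormal θ₀ T D) (i j : Fin (d + 1)) :
    (S.gram θ₀ D i j : ℂ) = symPair (S.ρ θ₀) (S.frame θ₀ D i) (S.frame θ₀ D j) :=
  Z_re_of_mem hρ hT (frame_mem hT hD) i j

theorem gram_transpose (hρ : (S.ρ θ₀).PosDef) (hT : S.IsInvariantExtension θ₀ T)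
    (hD : S.IsUnitNormal θ₀ T D) : (S.gram θ₀ D)ᵀ = S.gram θ₀ D := by
  ext i j
  apply Complex.ofReal_injective
  rw [Matrix.transpose_apply, gram_apply hρ hT hD, gram_apply hρ hT hD, symPair_comm]

theorem symPair_L_normal (hT : S.IsInvariantExtension θ₀ T) (hD : S.IsUnitNormal θ₀ T D)
    (i : Fin d) : symPair (S.ρ θ₀) (S.L θ₀ 0 i) D = 0 := by
  rw [← innerBeta_zero_eq_symPair (hT.hermitian _ (hT.sld_mem i)), hD.orthogonal]

theorem symPair_normal_self (hT : S.IsInvariantExtension θ₀ T) (hD : S.IsUnitNormal θ₀ T D) :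
    symPair (S.ρ θ₀) D D = 1 := by
  rw [← innerBeta_zero_eq_symPair (hT.hermitian _ hD.mem), hD.unit]

theorem linearIndependent_frame (hρ : (S.ρ θ₀).PosDef) (hT : S.IsInvariantExtension θ₀ T)
    (hD : S.IsUnitNormal θ₀ T D) (hindep : LinearIndependent ℝ (S.partialDeriv θ₀)) :
    LinearIndependent ℝ (S.frame θ₀ D) := by
  rw [frame, linearIndependent_finSnoc]
  refine ⟨linearIndependent_L hρ hindep, fun hmem => ?_⟩
  have hle : Submodule.span ℝ (Set.range (S.L θ₀ 0)) ≤
      LinearMap.ker (((symPair (S.ρ θ₀)).flip D).restrictScalars ℝ) := by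
    rw [Submodule.span_le]
    rintro _ ⟨i, rfl⟩
    simpa using symPair_L_normal hT hD i
  have h0 : symPair (S.ρ θ₀) D D = 0 := by simpa using hle hmem
  rw [symPair_normal_self hT hD] at h0
  exact one_ne_zero h0

theorem span_frame (hρ : (S.ρ θ₀).PosDef) (hT : S.IsInvariantExtension θ₀ T)
    (hD : S.IsUnitNormal θ₀ T D) (hindep : LinearIndependent ℝ (S.partialDeriv θ₀))
    (hdim : Module.finrank ℝ T = d + 1) :
    Submodule.span ℝ (Set.range (S.frame θ₀ D)) = T := by
  have : FiniteDimensional ℝ T := Module.finite_of_finrank_pos (by omega)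
  refine Submodule.eq_of_le_of_finrank_eq ?_ ?_
  · rw [Submodule.span_le]
    rintro _ ⟨i, rfl⟩
    exact frame_mem hT hD i
  · rw [finrank_span_eq_card (linearIndependent_frame hρ hT hD hindep), hdim, Fintype.card_fin]

theorem isUnit_gram (hρ : (S.ρ θ₀).PosDef) (hT : S.IsInvariantExtension θ₀ T)
    (hD : S.IsUnitNormal θ₀ T D) (hindep : LinearIndependent ℝ (S.partialDeriv θ₀)) :
    IsUnit (S.gram θ₀ D) := by
  rw [← Matrix.mulVec_injective_iff_isUnit]
  refine (injective_iff_map_eq_zero (Matrix.mulVecLin (S.gram θ₀ D))).2 fun c hc => ?_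
  set X := ∑ k, c k • S.frame θ₀ D k with hX
  have hXT : X ∈ T := T.sum_mem fun k _ => T.smul_mem _ (frame_mem hT hD k)
  have hXX : symPair (S.ρ θ₀) X X = ((c ⬝ᵥ (S.gram θ₀ D *ᵥ c) : ℝ) : ℂ) := by
    simp only [hX, map_sum, LinearMap.sum_apply, LinearMap.map_smul_of_tower,
      LinearMap.smul_apply, ← gram_apply hρ hT hD, dotProduct, Matrix.mulVec, Complex.real_smul,
      Finset.mul_sum, Complex.ofReal_sum, Complex.ofReal_mul]
    rw [Finset.sum_comm]
    exact Finset.sum_congr rfl fun i _ => Finset.sum_congr rfl fun j _ => by ring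
  rw [Matrix.mulVecLin_apply] at hc
  rw [hc, dotProduct_zero, Complex.ofReal_zero] at hXX
  have h0 := eq_zero_of_symPair_self_eq_zero hρ (hT.hermitian _ hXT) hXX
  exact funext (Fintype.linearIndependent_iff.1 (linearIndependent_frame hρ hT hD hindep) c h0)

theorem dualFrame_mem (hT : S.IsInvariantExtension θ₀ T) (hD : S.IsUnitNormal θ₀ T D)
    (j : Fin (d + 1)) : S.dualFrame θ₀ D j ∈ T :=
  T.sum_mem fun k _ => T.smul_mem _ (frame_mem hT hD k)

theorem symPair_frame_dualFrame (hρ : (S.ρ θ₀).PosDef) (hT : S.IsInvariantExtension θ₀ T)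
    (hD : S.IsUnitNormal θ₀ T D) (hindep : LinearIndependent ℝ (S.partialDeriv θ₀))
    (i j : Fin (d + 1)) :
    symPair (S.ρ θ₀) (S.frame θ₀ D i) (S.dualFrame θ₀ D j) = if i = j then 1 else 0 := by
  have h := congrFun (congrFun (Matrix.mul_nonsing_inv _
    ((Matrix.isUnit_iff_isUnit_det _).1 (isUnit_gram hρ hT hD hindep))) i) j
  rw [Matrix.mul_apply, Matrix.one_apply] at h
  simp only [dualFrame, map_sum, LinearMap.map_smul_of_tower, ← gram_apply hρ hT hD,
    Complex.real_smul]
  have h' := congrArg Complex.ofReal h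
  rw [Complex.ofReal_sum, apply_ite Complex.ofReal, Complex.ofReal_one, Complex.ofReal_zero] at h'
  rw [← h']
  exact Finset.sum_congr rfl fun k _ => by rw [Complex.ofReal_mul, mul_comm]

/-- Coordinates of an element of the space with respect to the frame. -/
theorem sum_symPair_dualFrame_smul (hρ : (S.ρ θ₀).PosDef) (hT : S.IsInvariantExtension θ₀ T)
    (hD : S.IsUnitNormal θ₀ T D) (hindep : LinearIndependent ℝ (S.partialDeriv θ₀))
    (hdim : Module.finrank ℝ T = d + 1) {X : Matrix n n ℂ} (hX : X ∈ T) :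
    X = ∑ j, symPair (S.ρ θ₀) X (S.dualFrame θ₀ D j) • S.frame θ₀ D j := by
  rw [← span_frame hρ hT hD hindep hdim] at hX
  obtain ⟨c, rfl⟩ := (Submodule.mem_span_range_iff_exists_fun ℝ).1 hX
  refine Finset.sum_congr rfl fun j _ => ?_
  simp only [map_sum, LinearMap.sum_apply, LinearMap.map_smul_of_tower, LinearMap.smul_apply,
    symPair_frame_dualFrame hρ hT hD hindep]
  simp

/-- The normal vector is its own dual, since it is a unit vector orthogonal to the other
members of the frame. -/
theorem dualFrame_last (hρ : (S.ρ θ₀).PosDef) (hT : S.IsInvariantExtension θ₀ T)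
    (hD : S.IsUnitNormal θ₀ T D) (hindep : LinearIndependent ℝ (S.partialDeriv θ₀))
    (hdim : Module.finrank ℝ T = d + 1) : S.dualFrame θ₀ D (Fin.last d) = D := by
  have hDd : ∀ j, symPair (S.ρ θ₀) D (S.dualFrame θ₀ D j) = if Fin.last d = j then 1 else 0 := by
    intro j
    have := symPair_frame_dualFrame hρ hT hD hindep (Fin.last d) j
    rwa [frame_last] at this
  have hcol : ∀ i, symPair (S.ρ θ₀) (S.frame θ₀ D i) (S.dualFrame θ₀ D (Fin.last d) - D) = 0 := by
    intro i
    rw [map_sub, symPair_frame_dualFrame hρ hT hD hindep]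
    refine Fin.lastCases ?_ (fun i => ?_) i
    · simp [symPair_normal_self hT hD]
    · simp [symPair_L_normal hT hD, Fin.castSucc_ne_last]
  have hm : S.dualFrame θ₀ D (Fin.last d) - D ∈ T := T.sub_mem (dualFrame_mem hT hD _) hD.mem
  rw [← sub_eq_zero]
  refine eq_zero_of_symPair_self_eq_zero hρ (hT.hermitian _ hm) ?_
  conv_lhs => enter [1]; rw [sum_symPair_dualFrame_smul hρ hT hD hindep hdim hm]
  simp only [map_sum, LinearMap.sum_apply, map_smul, LinearMap.smul_apply, hcol, smul_zero,
    Finset.sum_const_zero]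

theorem R_eq_Z_dualFrame (hρ : (S.ρ θ₀).PosDef) (hT : S.IsInvariantExtension θ₀ T)
    (hD : S.IsUnitNormal θ₀ T D) : S.R θ₀ D = S.Z θ₀ (S.dualFrame θ₀ D) := by
  have hsymm : ((S.gram θ₀ D)⁻¹)ᵀ = (S.gram θ₀ D)⁻¹ := by
    rw [Matrix.transpose_nonsing_inv, gram_transpose hρ hT hD]
  have e : S.R θ₀ D = toC (S.gram θ₀ D)⁻¹ * S.Z θ₀ (S.frame θ₀ D) * toC (S.gram θ₀ D)⁻¹ := rfl
  rw [e]
  ext i j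
  have hs : ∀ k, (S.gram θ₀ D)⁻¹ i k = (S.gram θ₀ D)⁻¹ k i := fun k =>
    (congrFun (congrFun hsymm k) i)
  simp only [Matrix.mul_apply, toC, Matrix.map_apply, Z, Matrix.of_apply, dualFrame,
    Finset.mul_sum, Finset.sum_mul, Matrix.trace_sum, Matrix.mul_smul, Matrix.smul_mul,
    Matrix.trace_smul, Complex.real_smul, hs]
  rw [Finset.sum_comm]
  exact Finset.sum_congr rfl fun i _ => Finset.sum_congr rfl fun j _ => by ring

/-! ### The matrix `R` and the inverse Fisher information matrices -/

theorem star_R (hρ : (S.ρ θ₀).PosDef) (hT : S.IsInvariantExtension θ₀ T)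
    (hD : S.IsUnitNormal θ₀ T D) (i j : Fin (d + 1)) : star (S.R θ₀ D i j) = S.R θ₀ D j i := by
  rw [R_eq_Z_dualFrame hρ hT hD, star_Z hρ fun i => hT.hermitian _ (dualFrame_mem hT hD i)]

theorem R_re_comm (hρ : (S.ρ θ₀).PosDef) (hT : S.IsInvariantExtension θ₀ T)
    (hD : S.IsUnitNormal θ₀ T D) (i j : Fin (d + 1)) :
    (S.R θ₀ D i j).re = (S.R θ₀ D j i).re := by
  rw [← star_R hρ hT hD j i]; simp

theorem R_im_comm (hρ : (S.ρ θ₀).PosDef) (hT : S.IsInvariantExtension θ₀ T)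
    (hD : S.IsUnitNormal θ₀ T D) (i j : Fin (d + 1)) :
    (S.R θ₀ D i j).im = -(S.R θ₀ D j i).im := by
  rw [← star_R hρ hT hD j i]; simp

theorem R_re (hρ : (S.ρ θ₀).PosDef) (hT : S.IsInvariantExtension θ₀ T)
    (hD : S.IsUnitNormal θ₀ T D) (i j : Fin (d + 1)) : ((S.R θ₀ D i j).re : ℂ) =
      symPair (S.ρ θ₀) (S.dualFrame θ₀ D i) (S.dualFrame θ₀ D j) := by
  rw [R_eq_Z_dualFrame hρ hT hD, Z_re_of_mem hρ hT (dualFrame_mem hT hD)]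

theorem R_im (hρ : (S.ρ θ₀).PosDef) (hT : S.IsInvariantExtension θ₀ T)
    (hD : S.IsUnitNormal θ₀ T D) (i j : Fin (d + 1)) : ((S.R θ₀ D i j).im : ℂ) =
      -symPair (S.ρ θ₀) (commOp (S.ρ θ₀) (S.dualFrame θ₀ D i)) (S.dualFrame θ₀ D j) := by
  rw [R_eq_Z_dualFrame hρ hT hD, Z_im_of_mem hρ hT (dualFrame_mem hT hD)]

theorem R_re_last (hρ : (S.ρ θ₀).PosDef) (hT : S.IsInvariantExtension θ₀ T)
    (hD : S.IsUnitNormal θ₀ T D) (hindep : LinearIndependent ℝ (S.partialDeriv θ₀))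
    (hdim : Module.finrank ℝ T = d + 1) (j : Fin (d + 1)) :
    (S.R θ₀ D (Fin.last d) j).re = if Fin.last d = j then 1 else 0 := by
  have h := symPair_frame_dualFrame hρ hT hD hindep (Fin.last d) j
  rw [frame_last] at h
  apply Complex.ofReal_injective
  rw [R_re hρ hT hD, dualFrame_last hρ hT hD hindep hdim, h]
  split_ifs <;> simp

theorem R_im_self (hρ : (S.ρ θ₀).PosDef) (hT : S.IsInvariantExtension θ₀ T)
    (hD : S.IsUnitNormal θ₀ T D) (i : Fin (d + 1)) : (S.R θ₀ D i i).im = 0 := by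
  linarith [R_im_comm hρ hT hD i i]

theorem R_castSucc_last (hρ : (S.ρ θ₀).PosDef) (hT : S.IsInvariantExtension θ₀ T)
    (hD : S.IsUnitNormal θ₀ T D) (hindep : LinearIndependent ℝ (S.partialDeriv θ₀))
    (hdim : Module.finrank ℝ T = d + 1) (i : Fin d) :
    S.R θ₀ D i.castSucc (Fin.last d) = Complex.I * S.b θ₀ D i := by
  apply Complex.ext
  · rw [R_re_comm hρ hT hD, R_re_last hρ hT hD hindep hdim,
      if_neg (Fin.castSucc_lt_last i).ne']
    simp
  · simp [b]

theorem R_last_castSucc (hρ : (S.ρ θ₀).PosDef) (hT : S.IsInvariantExtension θ₀ T)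
    (hD : S.IsUnitNormal θ₀ T D) (hindep : LinearIndependent ℝ (S.partialDeriv θ₀))
    (hdim : Module.finrank ℝ T = d + 1) (i : Fin d) :
    S.R θ₀ D (Fin.last d) i.castSucc = -(Complex.I * S.b θ₀ D i) := by
  rw [← star_R hρ hT hD, R_castSucc_last hρ hT hD hindep hdim]
  simp

theorem R_last_last (hρ : (S.ρ θ₀).PosDef) (hT : S.IsInvariantExtension θ₀ T)
    (hD : S.IsUnitNormal θ₀ T D) (hindep : LinearIndependent ℝ (S.partialDeriv θ₀))
    (hdim : Module.finrank ℝ T = d + 1) : S.R θ₀ D (Fin.last d) (Fin.last d) = 1 := by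
  apply Complex.ext
  · rw [R_re_last hρ hT hD hindep hdim]; simp
  · rw [R_im_self hρ hT hD]; simp

theorem dualFrame_eq_sum (hρ : (S.ρ θ₀).PosDef) (hT : S.IsInvariantExtension θ₀ T)
    (hD : S.IsUnitNormal θ₀ T D) (hindep : LinearIndependent ℝ (S.partialDeriv θ₀))
    (hdim : Module.finrank ℝ T = d + 1) (k : Fin (d + 1)) :
    S.dualFrame θ₀ D k = ∑ j, ((S.R θ₀ D j k).re : ℂ) • S.frame θ₀ D j := by
  rw [sum_symPair_dualFrame_smul hρ hT hD hindep hdim (dualFrame_mem hT hD k)]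
  exact Finset.sum_congr rfl fun j _ => by rw [R_re_comm hρ hT hD, R_re hρ hT hD]

theorem commOp_dualFrame_eq_sum (hρ : (S.ρ θ₀).PosDef) (hT : S.IsInvariantExtension θ₀ T)
    (hD : S.IsUnitNormal θ₀ T D) (hindep : LinearIndependent ℝ (S.partialDeriv θ₀))
    (hdim : Module.finrank ℝ T = d + 1) (k : Fin (d + 1)) :
    commOp (S.ρ θ₀) (S.dualFrame θ₀ D k) = ∑ j, ((S.R θ₀ D j k).im : ℂ) • S.frame θ₀ D j := by
  rw [sum_symPair_dualFrame_smul hρ hT hD hindep hdim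
    (hT.invariant _ (dualFrame_mem hT hD k))]
  refine Finset.sum_congr rfl fun j _ => ?_
  rw [R_im_comm hρ hT hD, Complex.ofReal_neg, R_im hρ hT hD, neg_neg]

variable (S θ₀ D) in
/-- The Schur complement `Re A + √-1 β Im A - β² b bᵀ` of the lower right entry in
`Re R + √-1 β Im R`. -/
def schurCompl (β : ℝ) : Matrix (Fin d) (Fin d) ℂ := Matrix.of fun i j =>
  ((S.A θ₀ D i j).re : ℂ) + Complex.I * β * (S.A θ₀ D i j).im - β ^ 2 * S.b θ₀ D i * S.b θ₀ D j

/-- The combination `Eₖ + √-1 β bₖ D` of the dual frame solves the `β` logarithmic derivative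
equation whose left side is the `k`-th column of `schurCompl` applied to the derivatives: the
coefficient of `D` is chosen so that the `D`-component of the twisted vector vanishes. -/
theorem betaMap_dualFrame_add (hρ : (S.ρ θ₀).PosDef) (hT : S.IsInvariantExtension θ₀ T)
    (hD : S.IsUnitNormal θ₀ T D) (hindep : LinearIndependent ℝ (S.partialDeriv θ₀))
    (hdim : Module.finrank ℝ T = d + 1) (β : ℝ) (k : Fin d) :
    betaMap (S.ρ θ₀) β (S.dualFrame θ₀ D k.castSucc
        + (Complex.I * β * S.b θ₀ D k) • S.dualFrame θ₀ D (Fin.last d))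
      = ∑ j, S.schurCompl θ₀ D β j k • S.partialDeriv θ₀ j := by
  have hre : ∀ j, (S.R θ₀ D j (Fin.last d)).re = if Fin.last d = j then 1 else 0 := fun j => by
    rw [R_re_comm hρ hT hD, R_re_last hρ hT hD hindep hdim]
  have hbk : (S.R θ₀ D (Fin.last d) k.castSucc).im = -S.b θ₀ D k := R_im_comm hρ hT hD _ _
  have hI : Complex.I * Complex.I = -1 := Complex.I_mul_I
  have key : ∀ j, betaMap (S.ρ θ₀) β (S.dualFrame θ₀ D j) =
      ∑ i, ((S.R θ₀ D i j).re + Complex.I * β * (S.R θ₀ D i j).im : ℂ) •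
        betaMap (S.ρ θ₀) 0 (S.frame θ₀ D i) := by
    intro j
    rw [betaMap_eq_betaMap_zero hρ, commOp_dualFrame_eq_sum hρ hT hD hindep hdim]
    conv_lhs => enter [2, 1]; rw [dualFrame_eq_sum hρ hT hD hindep hdim]
    simp only [Finset.smul_sum, ← Finset.sum_add_distrib, smul_smul, ← add_smul, map_sum, map_smul]
  rw [map_add, map_smul, key, key, Finset.smul_sum, ← Finset.sum_add_distrib,
    Fin.sum_univ_castSucc]
  simp only [smul_smul, ← add_smul, frame_castSucc, betaMap_zero_L hρ, hre, frame_last, hbk,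
    R_im_self hρ hT hD (Fin.last d), if_true]
  have hlast : ((S.R θ₀ D (Fin.last d) k.castSucc).re : ℂ) = 0 := by
    rw [R_re_last hρ hT hD hindep hdim, if_neg (Fin.castSucc_lt_last k).ne']; simp
  rw [hlast]
  have h0 : (0 + Complex.I * β * ((-S.b θ₀ D k : ℝ) : ℂ) + Complex.I * β * S.b θ₀ D k *
      (((1 : ℝ) : ℂ) + Complex.I * β * ((0 : ℝ) : ℂ)) : ℂ)
      = 0 := by
    simp
  rw [h0, zero_smul, add_zero]
  refine Finset.sum_congr rfl fun j _ => ?_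
  congr 1
  rw [if_neg (Fin.castSucc_lt_last j).ne']
  simp only [schurCompl, Matrix.of_apply, A, Matrix.submatrix_apply, b]
  push_cast
  linear_combination ((β : ℂ) ^ 2 * (S.R θ₀ D k.castSucc (Fin.last d)).im
    * (S.R θ₀ D j.castSucc (Fin.last d)).im) * hI

theorem inv_J (hρ : (S.ρ θ₀).PosDef) (hT : S.IsInvariantExtension θ₀ T)
    (hD : S.IsUnitNormal θ₀ T D) (hindep : LinearIndependent ℝ (S.partialDeriv θ₀))
    (hdim : Module.finrank ℝ T = d + 1) {β : ℝ} (hβ : |β| ≤ 1) :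
    (S.J θ₀ β)⁻¹ = S.schurCompl θ₀ D β := by
  refine Matrix.inv_eq_right_inv ?_
  ext i k
  have hu := betaMap_isUnit hρ hβ
  have hsum : ∑ j, S.schurCompl θ₀ D β j k • S.L θ₀ β j = S.dualFrame θ₀ D k.castSucc
        + (Complex.I * β * S.b θ₀ D k) • S.dualFrame θ₀ D (Fin.last d) := by
    have h1 : logDeriv (S.ρ θ₀) β (∑ j, S.schurCompl θ₀ D β j k • S.partialDeriv θ₀ j)
        = ∑ j, S.schurCompl θ₀ D β j k • S.L θ₀ β j := by
      simp only [logDeriv, map_sum, map_smul, L]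
    rw [← h1, logDeriv_spec hρ hβ, ← betaMap_apply, betaMap_dualFrame_add hρ hT hD hindep hdim]
  have h2 : (S.J θ₀ β * S.schurCompl θ₀ D β) i k
      = (S.partialDeriv θ₀ i * ∑ j, S.schurCompl θ₀ D β j k • S.L θ₀ β j).trace := by
    simp only [Matrix.mul_apply, J, Matrix.of_apply, Finset.mul_sum, Matrix.trace_sum,
      Matrix.mul_smul, Matrix.trace_smul, smul_eq_mul]
    exact Finset.sum_congr rfl fun j _ => mul_comm _ _
  rw [h2, hsum, trace_partialDeriv_mul hρ, ← frame_castSucc (D := D), map_add, map_smul,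
    symPair_frame_dualFrame hρ hT hD hindep, symPair_frame_dualFrame hρ hT hD hindep,
    if_neg (Fin.castSucc_lt_last i).ne, smul_zero, add_zero, Matrix.one_apply]
  simp

/-! ### Feasible points of the Holevo minimisation -/

variable (S θ₀ D) in
/-- The matrix `Z(B)` of the operators `Bⱼ = Eⱼ + fⱼ D`, where `E` is the dual frame. -/
def shiftedZ (f : Fin d → ℝ) : Matrix (Fin d) (Fin d) ℂ := Matrix.of fun i j =>
  S.A θ₀ D i j + f i * f j + Complex.I * (S.b θ₀ D i * f j - f i * S.b θ₀ D j)

variable (S θ₀ D) in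
/-- The operators `Bⱼ = Eⱼ + fⱼ D`, where `E` is the dual frame. -/
def shiftedDual (f : Fin d → ℝ) (j : Fin d) : Matrix n n ℂ :=
  S.dualFrame θ₀ D j.castSucc + (f j : ℂ) • S.dualFrame θ₀ D (Fin.last d)

theorem shiftedDual_mem (hT : S.IsInvariantExtension θ₀ T)
    (hD : S.IsUnitNormal θ₀ T D) (f : Fin d → ℝ) (j : Fin d) : S.shiftedDual θ₀ D f j ∈ T := by
  rw [shiftedDual, Complex.coe_smul]
  exact T.add_mem (dualFrame_mem hT hD _) (T.smul_mem _ (dualFrame_mem hT hD _))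

theorem Z_shiftedDual (hρ : (S.ρ θ₀).PosDef) (hT : S.IsInvariantExtension θ₀ T)
    (hD : S.IsUnitNormal θ₀ T D) (hindep : LinearIndependent ℝ (S.partialDeriv θ₀))
    (hdim : Module.finrank ℝ T = d + 1) (f : Fin d → ℝ) :
    S.Z θ₀ (S.shiftedDual θ₀ D f) = S.shiftedZ θ₀ D f := by
  have hR : ∀ i j, (S.ρ θ₀ * S.dualFrame θ₀ D j * S.dualFrame θ₀ D i).trace = S.R θ₀ D i j :=
    fun i j => by rw [R_eq_Z_dualFrame hρ hT hD]; rfl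
  ext i j
  simp only [Z, Matrix.of_apply, shiftedDual, mul_add, add_mul, Matrix.trace_add,
    Matrix.mul_smul, Matrix.smul_mul, Matrix.trace_smul, hR, smul_eq_mul,
    R_last_last hρ hT hD hindep hdim, R_castSucc_last hρ hT hD hindep hdim,
    R_last_castSucc hρ hT hD hindep hdim, shiftedZ, A, Matrix.submatrix_apply]
  ring

theorem symPair_frame_shiftedDual (hρ : (S.ρ θ₀).PosDef) (hT : S.IsInvariantExtension θ₀ T)
    (hD : S.IsUnitNormal θ₀ T D) (hindep : LinearIndependent ℝ (S.partialDeriv θ₀))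
    (f : Fin d → ℝ) (i : Fin (d + 1)) (j : Fin d) :
    symPair (S.ρ θ₀) (S.frame θ₀ D i) (S.shiftedDual θ₀ D f j)
      = (if i = j.castSucc then 1 else 0) + if i = Fin.last d then (f j : ℂ) else 0 := by
  rw [shiftedDual, map_add, map_smul, symPair_frame_dualFrame hρ hT hD hindep,
    symPair_frame_dualFrame hρ hT hD hindep]
  simp

theorem holevoFeasible_shiftedDual (hρ : (S.ρ θ₀).PosDef) (hT : S.IsInvariantExtension θ₀ T)
    (hD : S.IsUnitNormal θ₀ T D) (hindep : LinearIndependent ℝ (S.partialDeriv θ₀))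
    (hdim : Module.finrank ℝ T = d + 1) {f : Fin d → ℝ} {V : Matrix (Fin d) (Fin d) ℝ}
    (hV : (toC V - S.shiftedZ θ₀ D f).PosSemidef) :
    S.HolevoFeasible θ₀ V (S.shiftedDual θ₀ D f) where
  hermitian j := hT.hermitian _ (shiftedDual_mem hT hD f j)
  unbiased i j := by
    rw [trace_partialDeriv_mul hρ, ← frame_castSucc (D := D),
      symPair_frame_shiftedDual hρ hT hD hindep]
    simp [(Fin.castSucc_lt_last i).ne]
  le := by rwa [Z_shiftedDual hρ hT hD hindep hdim]

theorem posSemidef_Z (hρ : (S.ρ θ₀).PosDef) {ι : Type*} [Fintype ι] {B : ι → Matrix n n ℂ}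
    (hB : ∀ i, (B i).IsHermitian) : (S.Z θ₀ B).PosSemidef := by
  refine Matrix.PosSemidef.of_dotProduct_mulVec_nonneg ?_ fun x => ?_
  · ext i j
    exact star_Z hρ hB j i
  · have h := (hρ.posSemidef.conjTranspose_mul_mul_same (∑ j, x j • B j)).trace_nonneg
    convert h using 1
    rw [Matrix.mul_assoc, Matrix.trace_mul_comm]
    simp only [dotProduct, Matrix.mulVec, Z, Matrix.of_apply, Pi.star_apply,
      Matrix.conjTranspose_sum, Matrix.conjTranspose_smul, (hB _).eq, Finset.mul_sum,
      Finset.sum_mul, Matrix.trace_sum, Matrix.mul_smul, Matrix.smul_mul, Matrix.trace_smul,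
      smul_eq_mul]
    refine Finset.sum_congr rfl fun i _ => Finset.sum_congr rfl fun j _ => ?_
    ring

/-- The invariance of the space makes the components of `B` orthogonal to it contribute a
positive semidefinite summand to `Z(B)`, so that they can be dropped. -/
theorem HolevoFeasible.exists_posSemidef_sub_shiftedZ (hρ : (S.ρ θ₀).PosDef)
    (hT : S.IsInvariantExtension θ₀ T)
    (hD : S.IsUnitNormal θ₀ T D) (hindep : LinearIndependent ℝ (S.partialDeriv θ₀))
    (hdim : Module.finrank ℝ T = d + 1) {V : Matrix (Fin d) (Fin d) ℝ} {B : Fin d → Matrix n n ℂ}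
    (h : S.HolevoFeasible θ₀ V B) :
    ∃ f : Fin d → ℝ, (toC V - S.shiftedZ θ₀ D f).PosSemidef := by
  set f : Fin d → ℝ := fun j => (symPair (S.ρ θ₀) D (B j)).re
  set P := S.shiftedDual θ₀ D f with hP
  have hPT : ∀ j, P j ∈ T := shiftedDual_mem hT hD f
  set N : Fin d → Matrix n n ℂ := fun j => B j - P j with hN
  have hNh : ∀ j, (N j).IsHermitian := fun j => (h.hermitian j).sub (hT.hermitian _ (hPT j))
  have hFN : ∀ i j, symPair (S.ρ θ₀) (S.frame θ₀ D i) (N j) = 0 := by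
    intro i j
    rw [hN, map_sub, hP, symPair_frame_shiftedDual hρ hT hD hindep]
    refine Fin.lastCases ?_ (fun i => ?_) i
    · rw [frame_last,
        symPair_eq_ofReal hρ.isHermitian (hT.hermitian _ hD.mem) (h.hermitian j)]
      simp [f, (Fin.castSucc_lt_last j).ne']
    · rw [frame_castSucc, ← trace_partialDeriv_mul hρ, h.unbiased]
      simp [(Fin.castSucc_lt_last i).ne]
  have hTN : ∀ X ∈ T, ∀ j, symPair (S.ρ θ₀) X (N j) = 0 := by
    intro X hX j
    rw [sum_symPair_dualFrame_smul hρ hT hD hindep hdim hX]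
    simp only [map_sum, LinearMap.sum_apply, map_smul, LinearMap.smul_apply, hFN, smul_zero,
      Finset.sum_const_zero]
  have hcross : ∀ i j, (S.ρ θ₀ * N j * P i).trace = 0 := fun i j => by
    rw [trace_mul_mul_eq_symPair hρ, hTN _ (hPT i), hTN _ (hT.invariant _ (hPT i))]
    simp
  have hcross' : ∀ i j, (S.ρ θ₀ * P j * N i).trace = 0 := fun i j => by
    rw [← star_trace_mul_mul hρ.isHermitian (hNh i) (hT.hermitian _ (hPT j)), hcross, star_zero]
  have hZ : S.Z θ₀ B = S.shiftedZ θ₀ D f + S.Z θ₀ N := by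
    rw [← Z_shiftedDual hρ hT hD hindep hdim, ← hP]
    have hB : B = fun j => P j + N j := by funext j; simp [hN]
    rw [hB]
    ext i j
    simp only [Z, Matrix.of_apply, Matrix.add_apply, mul_add, add_mul, Matrix.trace_add, hcross,
      hcross']
    ring
  refine ⟨f, ?_⟩
  have := h.le.add (posSemidef_Z hρ hNh)
  rwa [hZ, sub_add_eq_sub_sub, sub_add_cancel] at this

end QuantumModel

end general

/-! ### Two by two matrices -/

theorem absM_smul_rotation (a : ℝ) :
    absM !![0, -a; a, 0] = |a| • (1 : Matrix (Fin 2) (Fin 2) ℝ) := by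
  have h : (!![0, -a; a, 0] : Matrix (Fin 2) (Fin 2) ℝ)ᵀ * !![0, -a; a, 0]
      = (|a| • (1 : Matrix (Fin 2) (Fin 2) ℝ)) * (|a| • (1 : Matrix (Fin 2) (Fin 2) ℝ)) := by
    rw [smul_mul_smul_comm, abs_mul_abs_self]
    ext i j
    fin_cases i <;> fin_cases j <;> simp [Matrix.mul_apply, Fin.sum_univ_two]
  rw [absM, h, CFC.sqrt_mul_self _ (Matrix.nonneg_iff_posSemidef.2
    (Matrix.PosSemidef.one.smul (abs_nonneg a)))]

theorem mul_antisymm_mul_apply {H K : Matrix (Fin 2) (Fin 2) ℝ} (hH : H 0 1 = H 1 0)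
    (hK : ∀ i j, K i j = -K j i) :
    H * K * H = !![0, -(H.det * K 1 0); H.det * K 1 0, 0] := by
  have h0 : K 0 0 = 0 := by linarith [hK 0 0]
  have h1 : K 1 1 = 0 := by linarith [hK 1 1]
  have h2 := hK 0 1
  ext i j
  fin_cases i <;> fin_cases j <;>
    simp [Matrix.mul_apply, Fin.sum_univ_two, Matrix.det_fin_two, h0, h1, h2, hH] <;> ring

section sqrt

variable {G : Matrix (Fin 2) (Fin 2) ℝ}

theorem sqrt_mul_sqrt_of_posDef (hG : G.PosDef) : CFC.sqrt G * CFC.sqrt G = G :=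
  CFC.sqrt_mul_sqrt_self G (Matrix.nonneg_iff_posSemidef.2 hG.posSemidef)

theorem sqrt_apply_comm : CFC.sqrt G 0 1 = CFC.sqrt G 1 0 := by
  have h := (Matrix.nonneg_iff_posSemidef.1 (CFC.sqrt_nonneg G)).isHermitian
  simpa using (h.apply 0 1).symm

theorem det_sqrt_ne_zero (hG : G.PosDef) : (CFC.sqrt G).det ≠ 0 := by
  intro h
  have h1 := congrArg Matrix.det (sqrt_mul_sqrt_of_posDef hG)
  rw [Matrix.det_mul, h, zero_mul] at h1
  exact hG.det_pos.ne h1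

theorem imCost_eq (Z : Matrix (Fin 2) (Fin 2) ℂ) (hZ : ∀ i j, (Z i j).im = -(Z j i).im) :
    imCost G Z = 2 * |(CFC.sqrt G).det * (Z 1 0).im| := by
  rw [imCost, mul_antisymm_mul_apply (K := imM Z) sqrt_apply_comm hZ, absM_smul_rotation,
    Matrix.trace_smul, Matrix.trace_one]
  simp [imM, mul_comm]

end sqrt

/-- A Hermitian positive semidefinite `N` satisfies `2 |√G (Im N) √G| ≤ Tr G Re N`, here with
`H = √G` and either sign in place of the absolute value: evaluate the form at `H (1, ±√-1)`. -/
theorem two_mul_det_mul_im_le {H : Matrix (Fin 2) (Fin 2) ℝ} (hH : H 0 1 = H 1 0)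
    {N : Matrix (Fin 2) (Fin 2) ℂ} (hN : N.PosSemidef) {ε : ℝ} (hε : ε ^ 2 = 1) :
    2 * ε * (H.det * (N 1 0).im) ≤ (H * H * reM N).trace := by
  have h := hN.dotProduct_mulVec_nonneg
    ![(H 0 0 : ℂ) - Complex.I * ε * H 1 0, (H 1 0 : ℂ) - Complex.I * ε * H 1 1]
  have h' := (Complex.le_def.1 h).1
  have h01 : N 0 1 = star (N 1 0) := (hN.isHermitian.apply 0 1).symm
  have h00 : (N 0 0).im = 0 := Complex.conj_eq_iff_im.1 (hN.isHermitian.apply 0 0)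
  have h11 : (N 1 1).im = 0 := Complex.conj_eq_iff_im.1 (hN.isHermitian.apply 1 1)
  simp [dotProduct, Matrix.mulVec, Fin.sum_univ_two, h01, h00, h11] at h'
  simp [Matrix.trace_fin_two, Matrix.mul_apply, Fin.sum_univ_two, reM, Matrix.det_fin_two, hH, h01]
  linear_combination h' + ((N 0 0).re * (H 1 0) ^ 2 + 2 * (N 1 0).re * H 1 0 * H 1 1
    + (N 1 1).re * (H 1 1) ^ 2) * hε

namespace QuantumModel

variable {n : Type*} [Fintype n] {S : QuantumModel 2 n} {θ₀ : EuclideanSpace ℝ (Fin 2)}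
  {T : Submodule ℝ (Matrix n n ℂ)} {D : Matrix n n ℂ} {G : Matrix (Fin 2) (Fin 2) ℝ}

theorem A_im_comm (hρ : (S.ρ θ₀).PosDef) (hT : S.IsInvariantExtension θ₀ T)
    (hD : S.IsUnitNormal θ₀ T D) (i j : Fin 2) :
    (S.A θ₀ D i j).im = -(S.A θ₀ D j i).im := R_im_comm hρ hT hD _ _

theorem a_eq (hρ : (S.ρ θ₀).PosDef) (hT : S.IsInvariantExtension θ₀ T)
    (hD : S.IsUnitNormal θ₀ T D) :
    S.a θ₀ G D = (CFC.sqrt G).det * (S.A θ₀ D 1 0).im := by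
  rw [a, mul_antisymm_mul_apply (K := imM (S.A θ₀ D)) sqrt_apply_comm
    (A_im_comm hρ hT hD)]
  simp [imM]

theorem imCost_A (hρ : (S.ρ θ₀).PosDef) (hT : S.IsInvariantExtension θ₀ T)
    (hD : S.IsUnitNormal θ₀ T D) : imCost G (S.A θ₀ D) = 2 * |S.a θ₀ G D| := by
  rw [imCost_eq _ (A_im_comm hρ hT hD), a_eq hρ hT hD]

theorem g₁_eq (hρ : (S.ρ θ₀).PosDef) (hT : S.IsInvariantExtension θ₀ T)
    (hD : S.IsUnitNormal θ₀ T D) (β : ℝ) : S.g₁ θ₀ G D β =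
      (G * reM (S.A θ₀ D)).trace + 2 * β * |S.a θ₀ G D| - β ^ 2 * S.bGb θ₀ G D := by
  rw [g₁, imCost_A hρ hT hD]; ring

theorem schurCompl_re (β : ℝ) (i j : Fin 2) : (S.schurCompl θ₀ D β i j).re
    = (S.A θ₀ D i j).re - β ^ 2 * S.b θ₀ D i * S.b θ₀ D j := by
  simp [schurCompl, ← Complex.ofReal_pow]

theorem schurCompl_im (β : ℝ) (i j : Fin 2) : (S.schurCompl θ₀ D β i j).im
    = β * (S.A θ₀ D i j).im := by
  simp [schurCompl, ← Complex.ofReal_pow]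

theorem imCost_schurCompl (hρ : (S.ρ θ₀).PosDef) (hT : S.IsInvariantExtension θ₀ T)
    (hD : S.IsUnitNormal θ₀ T D) {β : ℝ} (hβ : 0 ≤ β) :
    imCost G (S.schurCompl θ₀ D β) = 2 * β * |S.a θ₀ G D| := by
  rw [imCost_eq, schurCompl_im, a_eq hρ hT hD, mul_left_comm, abs_mul, abs_of_nonneg hβ, mul_assoc]
  intro i j
  rw [schurCompl_im, schurCompl_im, A_im_comm hρ hT hD]
  ring

theorem betaBound_eq_g₁ (hρ : (S.ρ θ₀).PosDef) (hT : S.IsInvariantExtension θ₀ T)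
    (hD : S.IsUnitNormal θ₀ T D) (hindep : LinearIndependent ℝ (S.partialDeriv θ₀))
    (hdim : Module.finrank ℝ T = 3) {β : ℝ} (hβ : β ∈ Set.Icc (0 : ℝ) 1) :
    S.betaBound θ₀ G β = S.g₁ θ₀ G D β := by
  rw [betaBound, inv_J hρ hT hD hindep hdim (abs_le.2 ⟨by linarith [hβ.1], hβ.2⟩),
    imCost_schurCompl hρ hT hD hβ.1, g₁_eq hρ hT hD]
  simp [Matrix.trace_fin_two, Matrix.mul_apply, Fin.sum_univ_two, reM, toC, schurCompl_re, bGb,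
    dotProduct, Matrix.mulVec]
  ring

theorem bGb_nonneg (hG : G.PosDef) : 0 ≤ S.bGb θ₀ G D := by
  have h := hG.posSemidef.dotProduct_mulVec_nonneg (S.b θ₀ D)
  rwa [star_trivial] at h

theorem bGb_pos (hG : G.PosDef) (hb : S.b θ₀ D ≠ 0) : 0 < S.bGb θ₀ G D := by
  have h := hG.dotProduct_mulVec_pos hb
  rwa [star_trivial] at h

/-- The difference of the inverse Fisher information matrices in the formula for `betaHat` is
`b bᵀ`. -/
theorem betaHat_eq (hρ : (S.ρ θ₀).PosDef) (hG : G.PosDef) (hT : S.IsInvariantExtension θ₀ T)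
    (hD : S.IsUnitNormal θ₀ T D) (hindep : LinearIndependent ℝ (S.partialDeriv θ₀))
    (hdim : Module.finrank ℝ T = 3) :
    S.betaHat θ₀ G = if S.bGb θ₀ G D = 0 then ⊤
      else ((|S.a θ₀ G D| / S.bGb θ₀ G D : ℝ) : EReal) := by
  have hden : (G * (reM (S.schurCompl θ₀ D 0) - reM (S.schurCompl θ₀ D 1))).trace
      = S.bGb θ₀ G D := by
    simp [Matrix.trace_fin_two, Matrix.mul_apply, Fin.sum_univ_two, reM, schurCompl_re, bGb,
      dotProduct, Matrix.mulVec]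
    ring
  have hcond : S.schurCompl θ₀ D 0 = toC (reM (S.schurCompl θ₀ D 1)) ↔ S.bGb θ₀ G D = 0 := by
    constructor
    · intro h
      rw [← hden, h]
      have : reM (toC (reM (S.schurCompl θ₀ D 1))) = reM (S.schurCompl θ₀ D 1) := by
        ext i j; simp [reM, toC]
      rw [this]
      simp
    · intro h
      have hb : S.b θ₀ D = 0 := by
        by_contra hb
        exact (bGb_pos hG hb).ne' h
      ext i j
      simp [schurCompl, reM, toC, hb]
  rw [betaHat, inv_J hρ hT hD hindep hdim (by simp), inv_J hρ hT hD hindep hdim (by simp), hden,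
    imCost_schurCompl hρ hT hD zero_le_one, ite_not]
  simp only [hcond]
  rw [mul_one, mul_div_mul_left _ _ two_ne_zero]

/-! ### Weak duality and the points of the quadratic program -/

theorem g₁_le_of_mem_holevoValues (hρ : (S.ρ θ₀).PosDef) (hG : G.PosDef)
    (hT : S.IsInvariantExtension θ₀ T)
    (hD : S.IsUnitNormal θ₀ T D) (hindep : LinearIndependent ℝ (S.partialDeriv θ₀))
    (hdim : Module.finrank ℝ T = 3) {β : ℝ} (hβ : β ∈ Set.Icc (0 : ℝ) 1) {x : ℝ}
    (hx : x ∈ S.holevoValues θ₀ G) : S.g₁ θ₀ G D β ≤ x := by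
  obtain ⟨V, B, hVB, rfl⟩ := hx
  obtain ⟨f, hf⟩ := hVB.exists_posSemidef_sub_shiftedZ hρ hT hD hindep hdim
  rw [g₁_eq hρ hT hD, a_eq hρ hT hD]
  set H := CFC.sqrt G with hHdef
  have hH : H 0 1 = H 1 0 := sqrt_apply_comm
  have hHG : H * H = G := sqrt_mul_sqrt_of_posDef hG
  set s := H.det * (S.A θ₀ D 1 0).im with hs
  obtain ⟨ε, hε, hεs⟩ : ∃ ε : ℝ, ε ^ 2 = 1 ∧ |s| = ε * s := by
    rcases abs_cases s with ⟨h, -⟩ | ⟨h, -⟩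
    · exact ⟨1, by norm_num, by linarith⟩
    · exact ⟨-1, by norm_num, by linarith⟩
  -- The two signs are combined with weights `(1 ± β) / 2`.
  have h1 := two_mul_det_mul_im_le hH hf hε
  have h2 := two_mul_det_mul_im_le hH hf (ε := -ε) (by rw [neg_sq, hε])
  have h3 : -2 * β * ε * (H.det * ((toC V - S.shiftedZ θ₀ D f) 1 0).im)
      ≤ (H * H * reM (toC V - S.shiftedZ θ₀ D f)).trace := by
    nlinarith [hβ.1, hβ.2]
  have h4 : ((toC V - S.shiftedZ θ₀ D f) 1 0).im
      = -((S.A θ₀ D 1 0).im + (S.b θ₀ D 1 * f 0 - f 1 * S.b θ₀ D 0)) := by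
    simp [toC, shiftedZ]
  have h5 : (H * H * reM (toC V - S.shiftedZ θ₀ D f)).trace
      = (G * V).trace - (G * reM (S.A θ₀ D)).trace - f ⬝ᵥ (G *ᵥ f) := by
    rw [hHG]
    simp [Matrix.trace_fin_two, Matrix.mul_apply, Fin.sum_univ_two, reM, toC, shiftedZ,
      dotProduct, Matrix.mulVec]
    ring
  rw [h4, h5] at h3
  -- Completing the square in `H f`; the rotated vector `H b` is optimal.
  have h6 : -(2 * β * ε * (H.det * (S.b θ₀ D 1 * f 0 - f 1 * S.b θ₀ D 0)))
      ≤ f ⬝ᵥ (G *ᵥ f) + β ^ 2 * S.bGb θ₀ G D := by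
    have e0 := sq_nonneg ((H 0 0 * f 0 + H 1 0 * f 1)
      + β * ε * (H 1 0 * S.b θ₀ D 0 + H 1 1 * S.b θ₀ D 1))
    have e1 := sq_nonneg ((H 1 0 * f 0 + H 1 1 * f 1)
      - β * ε * (H 0 0 * S.b θ₀ D 0 + H 1 0 * S.b θ₀ D 1))
    unfold bGb
    rw [← hHG]
    simp [dotProduct, Matrix.mulVec, Fin.sum_univ_two, Matrix.mul_apply,
      Matrix.det_fin_two, hH]
    linear_combination e0 + e1 + β ^ 2 * ((H 0 0 * S.b θ₀ D 0 + H 1 0 * S.b θ₀ D 1) ^ 2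
      + (H 1 0 * S.b θ₀ D 0 + H 1 1 * S.b θ₀ D 1) ^ 2) * hε
  rw [hεs, hs]
  linarith

theorem g₂_mem_holevoValues (hρ : (S.ρ θ₀).PosDef) (hG : G.PosDef)
    (hT : S.IsInvariantExtension θ₀ T)
    (hD : S.IsUnitNormal θ₀ T D) (hindep : LinearIndependent ℝ (S.partialDeriv θ₀))
    (hdim : Module.finrank ℝ T = 3) {t : ℝ} (ht : 0 ≤ S.con θ₀ G D t) :
    S.g₂ θ₀ G D t ∈ S.holevoValues θ₀ G := by
  have hae := a_eq (G := G) hρ hT hD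
  set H := CFC.sqrt G with hHdef
  have hH : H 0 1 = H 1 0 := sqrt_apply_comm
  have hHG : H * H = G := sqrt_mul_sqrt_of_posDef hG
  have hδ : H.det ≠ 0 := det_sqrt_ne_zero hG
  obtain ⟨ε, hε, hεs⟩ : ∃ ε : ℝ, ε ^ 2 = 1 ∧ S.a θ₀ G D = ε * |S.a θ₀ G D| := by
    rcases abs_cases (S.a θ₀ G D) with ⟨h, -⟩ | ⟨h, -⟩
    · exact ⟨1, by norm_num, by linarith⟩
    · exact ⟨-1, by norm_num, by linarith⟩
  set m := S.con θ₀ G D t with hm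
  set c0 := H 0 0 * S.b θ₀ D 0 + H 1 0 * S.b θ₀ D 1 with hc0
  set c1 := H 1 0 * S.b θ₀ D 0 + H 1 1 * S.b θ₀ D 1 with hc1
  have hκ : S.bGb θ₀ G D = c0 ^ 2 + c1 ^ 2 := by
    simp only [bGb]
    rw [← hHG]
    simp [dotProduct, Matrix.mulVec, Fin.sum_univ_two, Matrix.mul_apply, hH, hc0, hc1]
    ring
  have hdet : H.det = H 0 0 * H 1 1 - H 1 0 ^ 2 := by rw [Matrix.det_fin_two, hH]; ring
  -- `H f` is `t ε` times the vector `H b` turned by a right angle.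
  set f : Fin 2 → ℝ := ![t * ε * (H 1 1 * c1 + H 1 0 * c0) / H.det,
    -(t * ε * (H 1 0 * c1 + H 0 0 * c0)) / H.det] with hf
  have hf0 : H 0 0 * f 0 + H 1 0 * f 1 = t * ε * c1 := by
    simp only [hf, Matrix.cons_val_zero, Matrix.cons_val_one]
    field_simp
    rw [hdet]; ring
  have hf1 : H 1 0 * f 0 + H 1 1 * f 1 = -(t * ε * c0) := by
    simp only [hf, Matrix.cons_val_zero, Matrix.cons_val_one]
    field_simp
    rw [hdet]; ring
  -- The multiple of `G⁻¹` that has to be added to `Re Z(B)` is the real part of a complex rank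
  -- one matrix; its vector `u + √-1 v` is `H⁻¹ (1, -√-1 ε)`.
  obtain ⟨u, hu0, hu1⟩ : ∃ u : Fin 2 → ℝ, H 0 0 * u 0 + H 1 0 * u 1 = 1 ∧
      H 1 0 * u 0 + H 1 1 * u 1 = 0 := by
    refine ⟨![H 1 1 / H.det, -H 1 0 / H.det], ?_, ?_⟩
    · simp only [Matrix.cons_val_zero, Matrix.cons_val_one]
      field_simp
      rw [hdet]; ring
    · simp only [Matrix.cons_val_zero, Matrix.cons_val_one]
      ring
  obtain ⟨v, hv0, hv1⟩ : ∃ v : Fin 2 → ℝ, H 0 0 * v 0 + H 1 0 * v 1 = 0 ∧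
      H 1 0 * v 0 + H 1 1 * v 1 = -ε := by
    refine ⟨![ε * H 1 0 / H.det, -(ε * H 0 0) / H.det], ?_, ?_⟩
    · simp only [Matrix.cons_val_zero, Matrix.cons_val_one]
      ring
    · simp only [Matrix.cons_val_zero, Matrix.cons_val_one]
      field_simp
      rw [hdet]; ring
  have huv : u 0 * v 1 - u 1 * v 0 = -ε / H.det := by
    rw [eq_div_iff hδ, hdet]
    linear_combination (H 1 0 * v 0 + H 1 1 * v 1) * hu0 + hv1
      - (H 0 0 * v 0 + H 1 0 * v 1) * hu1
  set w : Fin 2 → ℂ := fun i => u i + Complex.I * v i with hw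
  set N : Matrix (Fin 2) (Fin 2) ℂ := (m : ℂ) • Matrix.vecMulVec w (star w) with hN
  have hNpos : N.PosSemidef :=
    (Matrix.posSemidef_vecMulVec_self_star w).smul (Complex.zero_le_real.2 ht)
  have hcross : (S.A θ₀ D 1 0).im + (S.b θ₀ D 1 * f 0 - f 1 * S.b θ₀ D 0) = ε * m / H.det := by
    rw [eq_div_iff hδ]
    have h1 : H.det * (S.b θ₀ D 1 * f 0 - f 1 * S.b θ₀ D 0) = t * ε * (c0 ^ 2 + c1 ^ 2) := by
      have : H.det * (S.b θ₀ D 1 * f 0 - f 1 * S.b θ₀ D 0)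
          = (H 0 0 * f 0 + H 1 0 * f 1) * c1 - (H 1 0 * f 0 + H 1 1 * f 1) * c0 := by
        rw [hdet, hc0, hc1]; ring
      rw [this, hf0, hf1]; ring
    have h2 : m = |S.a θ₀ G D| + (c0 ^ 2 + c1 ^ 2) * t := by rw [hm, con, hκ]
    rw [h2]
    linear_combination h1 - hae + hεs
  -- The imaginary part of `N` cancels that of `-Z(B)`, so `N = V - Z(B)` for the real matrix
  -- `V = Re Z(B) + Re N`.
  have hNim : ∀ i j, (N i j).im = -(S.shiftedZ θ₀ D f i j).im := by
    have eN : ∀ i j, (N i j).im = m * (u j * v i - u i * v j) := fun i j => by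
      simp [hN, hw, Matrix.vecMulVec_apply]
      left
      ring
    have eZ : ∀ i j, (S.shiftedZ θ₀ D f i j).im
        = (S.A θ₀ D i j).im + (S.b θ₀ D i * f j - f i * S.b θ₀ D j) := fun i j => by
      simp [shiftedZ]
    have h10 : (N 1 0).im = -(S.shiftedZ θ₀ D f 1 0).im := by
      rw [eN, eZ, hcross, huv]; ring
    have hanti := A_im_comm hρ hT hD
    refine Fin.forall_fin_two.2 ⟨Fin.forall_fin_two.2 ⟨?_, ?_⟩, Fin.forall_fin_two.2 ⟨?_, ?_⟩⟩
    · rw [eN, eZ]; linear_combination hanti 0 0 / 2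
    · rw [eN, eZ] at h10 ⊢; linear_combination -h10 + hanti 0 1
    · exact h10
    · rw [eN, eZ]; linear_combination hanti 1 1 / 2
  refine ⟨reM (S.shiftedZ θ₀ D f) + reM N, S.shiftedDual θ₀ D f,
    holevoFeasible_shiftedDual hρ hT hD hindep hdim ?_, ?_⟩
  · convert hNpos using 1
    ext i j
    apply Complex.ext
    · simp [toC, reM]
    · simp [toC, reM, hNim]
  · have eN : ∀ i j, reM N i j = m * (u i * u j + v i * v j) := fun i j => by
      simp [hN, hw, Matrix.vecMulVec_apply, reM]
    have eZ : ∀ i j, reM (S.shiftedZ θ₀ D f) i j = reM (S.A θ₀ D) i j + f i * f j :=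
      fun i j => by
        simp [shiftedZ, reM]
    rw [g₂, hκ]
    simp only [Matrix.trace_fin_two, Matrix.mul_apply, Fin.sum_univ_two, Matrix.add_apply, eN, eZ]
    have hG00 : G 0 0 = H 0 0 ^ 2 + H 1 0 ^ 2 := by
      rw [← hHG]; simp [Matrix.mul_apply, hH]; ring
    have hG01 : G 0 1 = H 0 0 * H 1 0 + H 1 0 * H 1 1 := by
      rw [← hHG]; simp [Matrix.mul_apply, hH]
    have hG10 : G 1 0 = H 0 0 * H 1 0 + H 1 0 * H 1 1 := by
      rw [← hHG]; simp [Matrix.mul_apply]; ring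
    have hG11 : G 1 1 = H 1 0 ^ 2 + H 1 1 ^ 2 := by
      rw [← hHG]; simp [Matrix.mul_apply, hH]; ring
    have hm' : m = |S.a θ₀ G D| + (c0 ^ 2 + c1 ^ 2) * t := by rw [hm, con, hκ]
    -- `Tr G f fᵀ = |H f|²`, `Tr G u uᵀ = |H u|²` and `Tr G v vᵀ = |H v|²`.
    have ef : G 0 0 * (f 0 * f 0) + G 0 1 * (f 1 * f 0) + (G 1 0 * (f 0 * f 1)
        + G 1 1 * (f 1 * f 1)) = (c0 ^ 2 + c1 ^ 2) * t ^ 2 := by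
      have : (H 0 0 * f 0 + H 1 0 * f 1) ^ 2 + (H 1 0 * f 0 + H 1 1 * f 1) ^ 2
          = (c0 ^ 2 + c1 ^ 2) * t ^ 2 := by
        rw [hf0, hf1]; linear_combination (c0 ^ 2 + c1 ^ 2) * t ^ 2 * hε
      rw [← this, hG00, hG01, hG10, hG11]; ring
    have eu : G 0 0 * (u 0 * u 0) + G 0 1 * (u 1 * u 0) + (G 1 0 * (u 0 * u 1)
        + G 1 1 * (u 1 * u 1)) = 1 := by
      have : (H 0 0 * u 0 + H 1 0 * u 1) ^ 2 + (H 1 0 * u 0 + H 1 1 * u 1) ^ 2 = 1 := by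
        rw [hu0, hu1]; norm_num
      rw [← this, hG00, hG01, hG10, hG11]; ring
    have ev : G 0 0 * (v 0 * v 0) + G 0 1 * (v 1 * v 0) + (G 1 0 * (v 0 * v 1)
        + G 1 1 * (v 1 * v 1)) = 1 := by
      have : (H 0 0 * v 0 + H 1 0 * v 1) ^ 2 + (H 1 0 * v 0 + H 1 1 * v 1) ^ 2 = 1 := by
        rw [hv0, hv1]; linear_combination hε
      rw [← this, hG00, hG01, hG10, hG11]; ring
    linear_combination -ef - m * eu - m * ev - 2 * hm'

end QuantumModel

/-! ### The scalar optimisation problem -/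

/-- The point `β = min(1, s / κ)` of `[0, 1]` satisfies the constraint `κ β ≤ s` and complementary
slackness for the multiplier `1 - β`. -/
theorem exists_saddle {s κ : ℝ} (hs : 0 ≤ s) :
    ∃ β ∈ Set.Icc (0 : ℝ) 1, 0 ≤ s - κ * β ∧ (1 - β) * (s - κ * β) = 0 := by
  rcases le_or_gt κ s with h | h
  · exact ⟨1, by simp, by linarith, by ring⟩
  · have h0 : 0 < κ := hs.trans_lt h
    have e : s - κ * (s / κ) = 0 := by rw [mul_div_cancel₀ _ h0.ne', sub_self]
    exact ⟨s / κ, ⟨by positivity, (div_le_one h0).2 h.le⟩, e.ge, by rw [e, mul_zero]⟩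

/-- Under complementary slackness `β` maximises the parabola `2 γ s - γ² κ` over all `γ ≤ 1`, not
only over `[0, 1]`; this is what the dual problem with multipliers `λ = 2 - 2 γ ≥ 0` needs. -/
theorem two_mul_sub_sq_mul_le {s κ β γ : ℝ} (hκ : 0 ≤ κ) (hγ : γ ≤ 1) (h : 0 ≤ s - κ * β)
    (h0 : (1 - β) * (s - κ * β) = 0) :
    2 * γ * s - γ ^ 2 * κ ≤ 2 * β * s - β ^ 2 * κ := by
  nlinarith [mul_nonneg hκ (sq_nonneg (γ - β)), mul_nonneg (sub_nonneg.2 hγ) h]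

end QuantumEstimation

end

open QuantumEstimation QuantumModel in
theorem mainTheorem6 {n : Type*} [Fintype n] (S : QuantumEstimation.QuantumModel 2 n)
    (θ₀ : EuclideanSpace ℝ (Fin 2)) (hθ₀ : θ₀ ∈ interior S.Θ)
    (hfaithful : (S.ρ θ₀).PosDef)
    (hindep : LinearIndependent ℝ (S.partialDeriv θ₀))
    (G : Matrix (Fin 2) (Fin 2) ℝ) (hG : G.PosDef)
    (T : Submodule ℝ (Matrix n n ℂ)) (hT : S.IsInvariantExtension θ₀ T)
    (hdim : Module.finrank ℝ T = 3) :
    -- both optima are attained, and the two bounds coincide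
    IsLeast (S.holevoValues θ₀ G) (S.holevoBound θ₀ G) ∧
    IsGreatest (S.betaBound θ₀ G '' Set.Icc 0 1) (S.mldBound θ₀ G) ∧
    S.holevoBound θ₀ G = S.mldBound θ₀ G ∧
    -- the explicit formula
    (1 ≤ S.betaHat θ₀ G → S.mldBound θ₀ G = S.betaBound θ₀ G 1) ∧
    (S.betaHat θ₀ G < 1 → S.mldBound θ₀ G = S.betaBound θ₀ G (S.betaHat θ₀ G).toReal) ∧
    -- the Lagrangian duality
    (∃ D, S.IsUnitNormal θ₀ T D) ∧
    ∀ D, S.IsUnitNormal θ₀ T D →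
      -- the quadratic program is a restriction of the Holevo minimisation with the same minimum
      (∀ t, 0 ≤ S.con θ₀ G D t → S.g₂ θ₀ G D t ∈ S.holevoValues θ₀ G) ∧
      IsLeast (S.g₂ θ₀ G D '' {t | 0 ≤ S.con θ₀ G D t}) (S.holevoBound θ₀ G) ∧
      -- its Lagrangian dual function
      (∀ l : ℝ, IsLeast
        (Set.range fun t => QuantumEstimation.lagrangian (S.g₂ θ₀ G D) (S.con θ₀ G D) t l)
        (S.g₁ θ₀ G D ((2 - l) / 2))) ∧
      (∀ β ∈ Set.Icc (0 : ℝ) 1, S.g₁ θ₀ G D β = S.betaBound θ₀ G β) ∧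
      -- the maximum in the dual problem
      IsGreatest ((fun l => S.g₁ θ₀ G D ((2 - l) / 2)) '' Set.Ici 0) (S.mldBound θ₀ G) := by
  -- Complementary slackness at `β` certifies `g₁(β)` as the value of both bounds. This is stated
  -- for every such `β`, so that it applies to `β = 1` and `β = β̂` in the explicit formula.
  have key : ∀ D, S.IsUnitNormal θ₀ T D → ∀ β ∈ Set.Icc (0 : ℝ) 1,
      0 ≤ |S.a θ₀ G D| - S.bGb θ₀ G D * β →
      (1 - β) * (|S.a θ₀ G D| - S.bGb θ₀ G D * β) = 0 →
      (∀ γ ≤ 1, S.g₁ θ₀ G D γ ≤ S.g₁ θ₀ G D β) ∧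
      S.mldBound θ₀ G = S.g₁ θ₀ G D β ∧ S.holevoBound θ₀ G = S.g₁ θ₀ G D β ∧
      0 ≤ S.con θ₀ G D (-β) ∧ S.g₂ θ₀ G D (-β) = S.g₁ θ₀ G D β := by
    intro D hD β hβ h h0
    have hmax : ∀ γ ≤ 1, S.g₁ θ₀ G D γ ≤ S.g₁ θ₀ G D β := fun γ hγ => by
      rw [g₁_eq hfaithful hT hD, g₁_eq hfaithful hT hD]
      linarith [two_mul_sub_sq_mul_le (bGb_nonneg (S := S) (θ₀ := θ₀) (D := D) hG) hγ h h0]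
    have hb := fun γ (hγ : γ ∈ Set.Icc (0 : ℝ) 1) =>
      betaBound_eq_g₁ (G := G) hfaithful hT hD hindep hdim hγ
    have hcon : 0 ≤ S.con θ₀ G D (-β) := by rw [con]; linarith
    have hval : S.g₂ θ₀ G D (-β) = S.g₁ θ₀ G D β := by
      rw [g₂, g₁_eq hfaithful hT hD]; linear_combination 2 * h0
    have hgreat : IsGreatest (S.betaBound θ₀ G '' Set.Icc 0 1) (S.g₁ θ₀ G D β) := by
      refine ⟨⟨β, hβ, hb β hβ⟩, ?_⟩
      rintro _ ⟨γ, hγ, rfl⟩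
      rw [hb γ hγ]
      exact hmax γ hγ.2
    have hleast : IsLeast (S.holevoValues θ₀ G) (S.g₁ θ₀ G D β) :=
      ⟨hval ▸ g₂_mem_holevoValues hfaithful hG hT hD hindep hdim hcon,
        fun x hx => g₁_le_of_mem_holevoValues hfaithful hG hT hD hindep hdim hβ hx⟩
    exact ⟨hmax, hgreat.csSup_eq, hleast.csInf_eq, hcon, hval⟩
  obtain ⟨D₀, hD₀⟩ := exists_isUnitNormal hfaithful hT hdim
  have hκ₀ : 0 ≤ S.bGb θ₀ G D₀ := bGb_nonneg hG
  have hb₀ := fun γ (hγ : γ ∈ Set.Icc (0 : ℝ) 1) =>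
    betaBound_eq_g₁ (G := G) hfaithful hT hD₀ hindep hdim hγ
  obtain ⟨β, hβ, h, h0⟩ := exists_saddle (κ := S.bGb θ₀ G D₀) (abs_nonneg (S.a θ₀ G D₀))
  obtain ⟨hmax, hmld, hhol, hcon, hval⟩ := key D₀ hD₀ β hβ h h0
  have hleast : IsLeast (S.holevoValues θ₀ G) (S.holevoBound θ₀ G) := by
    rw [hhol]
    exact ⟨hval ▸ g₂_mem_holevoValues hfaithful hG hT hD₀ hindep hdim hcon,
      fun x hx => g₁_le_of_mem_holevoValues hfaithful hG hT hD₀ hindep hdim hβ hx⟩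
  refine ⟨hleast, ?_, hhol.trans hmld.symm, ?_, ?_, ⟨D₀, hD₀⟩, ?_⟩
  · rw [hmld]
    refine ⟨⟨β, hβ, hb₀ β hβ⟩, ?_⟩
    rintro _ ⟨γ, hγ, rfl⟩
    rw [hb₀ γ hγ]
    exact hmax γ hγ.2
  · intro hhat
    have h1 : (1 : ℝ) ∈ Set.Icc (0 : ℝ) 1 := by simp
    rw [hb₀ 1 h1]
    refine (key D₀ hD₀ 1 h1 ?_ (by ring)).2.1
    rw [betaHat_eq hfaithful hG hT hD₀ hindep hdim] at hhat
    split_ifs at hhat with hz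
    · rw [hz]; linarith [abs_nonneg (S.a θ₀ G D₀)]
    · have h2 : 1 ≤ |S.a θ₀ G D₀| / S.bGb θ₀ G D₀ := by exact_mod_cast hhat
      rw [le_div_iff₀ (hκ₀.lt_of_ne' hz)] at h2
      linarith
  · intro hhat
    rw [betaHat_eq hfaithful hG hT hD₀ hindep hdim] at hhat ⊢
    split_ifs at hhat ⊢ with hz
    · exact absurd hhat (by simp)
    · have h2 : |S.a θ₀ G D₀| / S.bGb θ₀ G D₀ < 1 := by exact_mod_cast hhat
      have e : |S.a θ₀ G D₀| - S.bGb θ₀ G D₀ * (|S.a θ₀ G D₀| / S.bGb θ₀ G D₀) = 0 := by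
        rw [mul_div_cancel₀ _ hz, sub_self]
      have h3 : |S.a θ₀ G D₀| / S.bGb θ₀ G D₀ ∈ Set.Icc (0 : ℝ) 1 :=
        ⟨div_nonneg (abs_nonneg _) hκ₀, h2.le⟩
      rw [EReal.toReal_coe, hb₀ _ h3]
      exact (key D₀ hD₀ _ h3 e.ge (by rw [e, mul_zero])).2.1
  · intro D hD
    have hκ : 0 ≤ S.bGb θ₀ G D := bGb_nonneg hG
    obtain ⟨γ, hγ, h', h0'⟩ := exists_saddle (κ := S.bGb θ₀ G D) (abs_nonneg (S.a θ₀ G D))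
    obtain ⟨hmax', hmld', hhol', hcon', hval'⟩ := key D hD γ hγ h' h0'
    have hmem := fun t (ht : 0 ≤ S.con θ₀ G D t) =>
      g₂_mem_holevoValues hfaithful hG hT hD hindep hdim ht
    refine ⟨hmem, ⟨⟨-γ, hcon', hval'.trans hhol'.symm⟩, ?_⟩, fun l => ⟨⟨-((2 - l) / 2), ?_⟩, ?_⟩,
      fun β hβ => (betaBound_eq_g₁ hfaithful hT hD hindep hdim hβ).symm,
      ⟨⟨2 - 2 * γ, ?_, ?_⟩, ?_⟩⟩
    · rintro _ ⟨t, ht, rfl⟩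
      exact hleast.2 (hmem t ht)
    · simp only [lagrangian]
      rw [g₂, con, g₁_eq hfaithful hT hD]
      ring
    · rintro _ ⟨t, rfl⟩
      simp only [lagrangian]
      rw [g₂, con, g₁_eq hfaithful hT hD]
      nlinarith [mul_nonneg hκ (sq_nonneg (t + (2 - l) / 2))]
    · simp only [Set.mem_Ici]; linarith [hγ.2]
    · rw [hmld']
      simp only
      congr 1
      ring
    · rintro _ ⟨l, hl, rfl⟩
      rw [hmld']
      exact hmax' _ (by rw [Set.mem_Ici] at hl; linarith)
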